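/- Let $\mathbb C^n$ carry the inner product $\langle z,w\rangle=\sum_j z_j\overline{w_j}$ and the Euclidean norm, let $\mathbb B^n$ be its open unit ball, $\mathbb D$ the open unit disk, and let $J_f(z)$ denote the complex Jacobian matrix of $f$. Let $0<\gamma<1$ and let $f:\mathbb B^n\to\mathbb C^n$ be a normalized biholomorphic starlike mapping of order $\gamma$, that is: $f$ is holomorphic, $f(0)=0$, $J_f(0)=I_n$, $f$ has a holomorphic inverse on the open set $f(\mathbb B^n)$, and $$\Big\langle J_f(z)^{-1}f(z),\frac{z}{\|z\|^2}\Big\rangle\in g(\mathbb D)\quad\text{for all } z\in\mathbb B^n\setminus\{0\},\qquad\text{where } g(\zeta)=\frac{1-\zeta}{1+(1-2\gamma)\zeta}.$$ Let $z\in\mathbb B^n\setminus\{0\}$. (1) If $\|f(z)\|=\max_{\|\xi\|=\|z\|}\|f(\xi)\|$, then $$|\det J_f(z)|\le(1-\|z\|)^{2(\gamma-1)n}\left(\frac{1-\|z\|}{1+(1-2\gamma)\|z\|}\right)^{-\frac{n+1}{2}}$$ and, for every $\delta\in\mathbb C^n$ with $\langle\delta,z\rangle=0$ (that is, $\delta$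 in the holomorphic tangent space at $z$ to the sphere of radius $\|z\|$), $$\|J_f(z)\delta\|\le(1-\|z\|)^{2(\gamma-1)}\left(\frac{1-\|z\|}{1+(1-2\gamma)\|z\|}\right)^{-\frac12}\|\delta\|.$$ (2) If $\|f(z)\|=\min_{\|\xi\|=\|z\|}\|f(\xi)\|$, then $$|\det J_f(z)|\ge(1+\|z\|)^{-2(1-\gamma)n}\left(\frac{1+\|z\|}{1-(1-2\gamma)\|z\|}\right)^{-\frac{n+1}{2}}$$ and, for every $\delta\in\mathbb C^n$ with $\langle\delta,z\rangle=0$, $$\|J_f(z)\delta\|\ge(1+\|z\|)^{-2(1-\gamma)}\left(\frac{1+\|z\|}{1-(1-2\gamma)\|z\|}\right)^{-\frac12}\|\delta\|.$$ -/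

import Mathlib

namespace StarlikeDistortion

/-- `ℂⁿ` with its Hermitian inner product and Euclidean norm. Mathlib's `inner ℂ w z` is conjugate
linear in `w`, so it is `∑ j, z j * conj (w j)`, that is `w̄' z`. -/
abbrev Cn (n : ℕ) : Type := EuclideanSpace ℂ (Fin n)

/-- The open unit ball `𝔹ⁿ` of `ℂⁿ`. -/
def unitBall (n : ℕ) : Set (Cn n) := Metric.ball 0 1

/-- The complex derivative `J_f(z)`, as the linear map whose matrix is `(∂f_i/∂z_j (z))`. -/
noncomputable def jacobian {n : ℕ} (f : Cn n → Cn n) (z : Cn n) : Cn n →L[ℂ] Cn n :=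
  fderiv ℂ f z

/-- `f` is holomorphic on the unit ball with `f(0) = 0` and `J_f(0) = I`. -/
structure IsNormalizedHolomorphic {n : ℕ} (f : Cn n → Cn n) : Prop where
  holomorphic : DifferentiableOn ℂ f (unitBall n)
  map_zero : f 0 = 0
  jacobian_zero : jacobian f 0 = ContinuousLinearMap.id ℂ (Cn n)

/-- `f` is biholomorphic on the unit ball: it is holomorphic there, its image is open, and it has
an inverse which is holomorphic on the image. -/
structure IsBiholomorphicOnBall {n : ℕ} (f : Cn n → Cn n) : Prop where
  holomorphic : DifferentiableOn ℂ f (unitBall n)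
  isOpen_image : IsOpen (f '' unitBall n)
  exists_inverse : ∃ k : Cn n → Cn n,
    DifferentiableOn ℂ k (f '' unitBall n) ∧ ∀ z ∈ unitBall n, k (f z) = z

/-- The class `𝓜_g`: normalized holomorphic mappings `h` of the ball such that
`⟨h(z), z / ‖z‖²⟩ ∈ g(𝔻)` for all `z ≠ 0` in the ball. -/
structure MemM {n : ℕ} (g : ℂ → ℂ) (h : Cn n → Cn n) : Prop where
  normalized : IsNormalizedHolomorphic h
  mem_image : ∀ z ∈ unitBall n, z ≠ 0 →
    inner ℂ z (h z) / ((‖z‖ : ℂ) ^ 2) ∈ g '' Metric.ball (0 : ℂ) 1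

/-- `g`-starlike mappings: normalized locally biholomorphic mappings `f` of the ball such that
`z ↦ J_f(z)⁻¹ f(z)` belongs to `𝓜_g`. -/
structure IsGStarlike {n : ℕ} (g : ℂ → ℂ) (f : Cn n → Cn n) : Prop where
  normalized : IsNormalizedHolomorphic f
  nonsingular : ∀ z ∈ unitBall n, (jacobian f z).IsInvertible
  memM : MemM g (fun z => (jacobian f z).inverse (f z))

/-- The function `ζ ↦ (1 - ζ) / (1 + (1 - 2γ) ζ)`; for `0 < γ < 1` the denominator has no zero in
the unit disk. -/
noncomputable def orderFun (γ : ℝ) (ζ : ℂ) : ℂ := (1 - ζ) / (1 + (1 - 2 * (γ : ℂ)) * ζ)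

/-- Normalized biholomorphic starlike mappings of order `γ` on the unit ball: the normalized
biholomorphic mappings that are `g`-starlike for `g(ζ) = (1 - ζ) / (1 + (1 - 2γ) ζ)`. -/
structure IsStarlikeOfOrder {n : ℕ} (γ : ℝ) (f : Cn n → Cn n) : Prop where
  biholomorphic : IsBiholomorphicOnBall f
  gStarlike : IsGStarlike (orderFun γ) f

/-- The holomorphic tangent space at `z` to the sphere of radius `‖z‖` centred at `0`. -/
def holTangentSpace {n : ℕ} (z : Cn n) : Set (Cn n) := {w | inner ℂ z w = 0}

end StarlikeDistortion

open Metric Set Filter Topology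

/-! Write `r = ‖z‖` and `J = J_f(z)`. At an extremal point `z` of `‖f‖` on its sphere, the Lagrange
condition says that `J` maps the holomorphic tangent space into the complement of `f z` and that `L
= ⟨J z, f z⟩` is real. Hence `c = ⟨J⁻¹ f z, z⟩ / r²` is real with `c * L = ‖f z‖²`, and the Schwarz
lemma on the complex line through `z` puts `c` between `g(r)` and `g(-r)` (`exists_radial`).

Tangential directions are second-order information, obtained without second derivatives from discs
whose boundary lies on the sphere: `s • z + √(1 - s²) ζ • δ` with `‖δ‖ = r`. A maximum of `‖f‖`
gives `‖G 0‖² + ‖G' 0‖² ≤ ‖f z‖²` on such a disc, and `s → 1` turns this into `‖J δ‖² ≤ L = ‖f z‖² /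
c`. At a minimum the reverse holds up to an error that vanishes in the limit.

The ratio `A = ‖f z‖ / r` is controlled by a growth theorem, itself proved by comparison at extremal
points. With `m = A * c^(-1/2)` as the tangential bound, block diagonality of `J` gives `|det J| ≤
m^n / √c = A^n * c^(-(n+1)/2)` at a maximum and `≥` at a minimum. -/

theorem Complex.re_le_of_forall_sphere {H : ℂ → ℂ} (hH : DifferentiableOn ℂ H (closedBall 0 1))
    {M : ℝ} (hM : ∀ ζ : ℂ, ‖ζ‖ = 1 → (H ζ).re ≤ M) : (H 0).re ≤ M := by
  -- The modulus of `exp ∘ H` is `exp (re H)`, so the maximum modulus principle applies to real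
  -- parts.
  have hd : DiffContOnCl ℂ (fun ζ => Complex.exp (H ζ)) (ball 0 1) := by
    apply DifferentiableOn.diffContOnCl
    rw [closure_ball _ one_ne_zero]
    exact hH.cexp
  have := Complex.norm_le_of_forall_mem_frontier_norm_le (U := ball (0 : ℂ) 1)
    isBounded_ball hd (C := Real.exp M) (fun ζ hζ => by
      rw [frontier_ball _ one_ne_zero, mem_sphere_zero_iff_norm] at hζ
      rw [Complex.norm_exp]
      exact Real.exp_le_exp.2 (hM ζ hζ)) (z := 0) (subset_closure (by simp))
  rw [Complex.norm_exp] at this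
  exact Real.exp_le_exp.1 this

/-! ### Vector-valued holomorphic functions on the closed disc -/

section Disc

variable {F : Type*} [NormedAddCommGroup F] [InnerProductSpace ℂ F]

/-- The holomorphic function whose real part linearizes `‖G‖ ^ 2` on the unit circle. -/
noncomputable def discPotential (G : ℂ → F) (ζ : ℂ) : ℂ :=
  inner ℂ (G 0) (G ζ) + inner ℂ (deriv G 0) (dslope G 0 ζ)

theorem discPotential_zero (G : ℂ → F) :
    (discPotential G 0).re = ‖G 0‖ ^ 2 + ‖deriv G 0‖ ^ 2 := by
  simp only [discPotential, dslope_same, inner_self_eq_norm_sq_to_K, Complex.add_re]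
  norm_cast

theorem differentiableOn_discPotential [CompleteSpace F] {G : ℂ → F}
    (hG : DifferentiableOn ℂ G (closedBall 0 1)) :
    DifferentiableOn ℂ (discPotential G) (closedBall 0 1) := by
  have h2 : DifferentiableOn ℂ (dslope G 0) (closedBall 0 1) := by
    exact (Complex.differentiableOn_dslope (closedBall_mem_nhds _ one_pos)).2 hG
  exact ((innerSL ℂ (G 0)).differentiable.comp_differentiableOn hG).add
    ((innerSL ℂ (deriv G 0)).differentiable.comp_differentiableOn h2)

/-- On the unit circle `conj ζ * ζ = 1`, which makes the cross term with `ζ • deriv G 0` the real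
part of a holomorphic function, up to a term cancelling against the expansion of `‖G 0 + ζ • deriv G
0‖²`. -/
theorem norm_sub_affine_sq (G : ℂ → F) {ζ : ℂ} (hζ : ‖ζ‖ = 1) :
    ‖G ζ - G 0 - ζ • deriv G 0‖ ^ 2 =
      ‖G ζ‖ ^ 2 - 2 * (discPotential G ζ).re + ‖G 0‖ ^ 2 + ‖deriv G 0‖ ^ 2 := by
  have hζ0 : ζ ≠ 0 := by rintro rfl; simp at hζ
  have hd : G ζ = G 0 + ζ • dslope G 0 ζ := by
    rw [dslope_of_ne _ hζ0, slope_def_module]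
    simp [smul_smul, hζ0]
  have hc : (starRingEnd ℂ) ζ * ζ = 1 := by
    rw [mul_comm, Complex.mul_conj, Complex.normSq_eq_norm_sq, hζ]; simp
  set a := G 0
  set b := deriv G 0
  set D := dslope G 0 ζ
  have h1 : inner ℂ (ζ • b) (G ζ) = inner ℂ b D + (starRingEnd ℂ) (inner ℂ a (ζ • b)) := by
    rw [inner_conj_symm, hd, inner_add_right]
    simp only [inner_smul_left, inner_smul_right]
    linear_combination inner ℂ b D * hc
  have e1 : G ζ - a - ζ • b = G ζ - (a + ζ • b) := by abel
  rw [e1, @norm_sub_sq ℂ, @norm_add_sq ℂ, inner_re_symm, inner_add_left, h1, norm_smul, hζ]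
  simp only [discPotential, map_add, RCLike.re_eq_complex_re, Complex.conj_re, Complex.add_re]
  ring

/-- The first two terms of Parseval's inequality, with the maximum principle for `discPotential` in
place of integration. -/
theorem norm_sq_add_norm_deriv_sq_le [CompleteSpace F] {G : ℂ → F}
    (hG : DifferentiableOn ℂ G (closedBall 0 1)) {R : ℝ}
    (hR : ∀ ζ : ℂ, ‖ζ‖ = 1 → ‖G ζ‖ ≤ R) : ‖G 0‖ ^ 2 + ‖deriv G 0‖ ^ 2 ≤ R ^ 2 := by
  have := Complex.re_le_of_forall_sphere (differentiableOn_discPotential hG)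
    (M := (R ^ 2 + ‖G 0‖ ^ 2 + ‖deriv G 0‖ ^ 2) / 2) (fun ζ hζ => by
      have h1 := norm_sub_affine_sq G hζ
      have h2 := sq_nonneg ‖G ζ - G 0 - ζ • deriv G 0‖
      have h3 := pow_le_pow_left₀ (norm_nonneg _) (hR ζ hζ) 2
      linarith)
  rw [discPotential_zero] at this
  linarith

/-- The converse estimate loses only the higher Taylor terms, measured by `η`. -/
theorem le_norm_sq_add_norm_deriv_sq [CompleteSpace F] {G : ℂ → F}
    (hG : DifferentiableOn ℂ G (closedBall 0 1)) {R η : ℝ} (hR0 : 0 ≤ R)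
    (hR : ∀ ζ : ℂ, ‖ζ‖ = 1 → R ≤ ‖G ζ‖)
    (hη : ∀ ζ : ℂ, ‖ζ‖ = 1 → ‖G ζ - G 0 - ζ • deriv G 0‖ ≤ η) :
    R ^ 2 - η ^ 2 ≤ ‖G 0‖ ^ 2 + ‖deriv G 0‖ ^ 2 := by
  have := Complex.re_le_of_forall_sphere (differentiableOn_discPotential hG).neg
    (M := -((R ^ 2 - η ^ 2 + ‖G 0‖ ^ 2 + ‖deriv G 0‖ ^ 2) / 2)) (fun ζ hζ => by
      have h1 := norm_sub_affine_sq G hζ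
      have h2 := pow_le_pow_left₀ (norm_nonneg _) (hη ζ hζ) 2
      have h3 := pow_le_pow_left₀ hR0 (hR ζ hζ) 2
      simp only [Pi.neg_apply, Complex.neg_re]
      linarith)
  simp only [Pi.neg_apply, Complex.neg_re] at this
  rw [discPotential_zero] at this
  linarith

/-- Cauchy's estimate for the deviation of `G` from an affine function. -/
theorem norm_deriv_sub_le {G : ℂ → F} (hG : DifferentiableOn ℂ G (closedBall 0 1)) {β : F}
    {η : ℝ} (hη : ∀ ζ : ℂ, ‖ζ‖ = 1 → ‖G ζ - G 0 - ζ • β‖ ≤ η) : ‖deriv G 0 - β‖ ≤ η := by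
  have hd : DifferentiableAt ℂ G 0 := hG.differentiableAt (closedBall_mem_nhds _ one_pos)
  have h1 : HasDerivAt (fun ζ : ℂ => G ζ - G 0 - ζ • β) (deriv G 0 - β) 0 := by
    have := (hd.hasDerivAt.sub_const (G 0)).sub ((hasDerivAt_id (0 : ℂ)).smul_const β)
    rw [one_smul] at this
    exact this
  have h2 : DiffContOnCl ℂ (fun ζ : ℂ => G ζ - G 0 - ζ • β) (ball 0 1) := by
    apply DifferentiableOn.diffContOnCl
    rw [closure_ball _ one_ne_zero]
    fun_prop
  have := Complex.norm_deriv_le_of_forall_mem_sphere_norm_le one_pos h2 (C := η)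
    (fun ζ hζ => hη ζ (by simpa using hζ))
  rwa [h1.deriv, div_one] at this

end Disc

/-! ### Extremal points on spheres: Lagrange conditions and tangent discs -/

section Sphere

variable {E F : Type*} [NormedAddCommGroup E] [InnerProductSpace ℂ E]
  [NormedAddCommGroup F] [InnerProductSpace ℂ F]

theorem hasDerivAt_norm_sq_of_complex {φ : ℝ → F} {φ' : F} {t : ℝ} (h : HasDerivAt φ φ' t) :
    HasDerivAt (fun s => ‖φ s‖ ^ 2) (2 * (inner ℂ (φ t) φ').re) t := by
  have h1 := Complex.reCLM.hasFDerivAt.comp_hasDerivAt t (HasDerivAt.inner ℂ h h)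
  have h2 : (2 * (inner ℂ (φ t) φ').re) =
      Complex.reCLM (inner ℂ (φ t) φ' + inner ℂ φ' (φ t)) := by
    rw [Complex.reCLM_apply, Complex.add_re, ← RCLike.re_eq_complex_re,
      inner_re_symm (𝕜 := ℂ) φ' (φ t)]
    ring
  rw [h2]
  refine h1.congr_of_eventuallyEq (Eventually.of_forall fun s => ?_)
  simp only [Function.comp_apply, Complex.reCLM_apply]
  exact (inner_self_eq_norm_sq (𝕜 := ℂ) (φ s)).symm

theorem HasFDerivAt.comp_hasDerivAt_real {f : E → F} {J : E →L[ℂ] F} {g : ℝ → E} {g' : E} {t : ℝ}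
    (hf : HasFDerivAt f J (g t)) (hg : HasDerivAt g g' t) :
    HasDerivAt (fun s => f (g s)) (J g') t :=
  (hf.restrictScalars ℝ).comp_hasDerivAt t hg

theorem norm_add_sq_of_inner_eq_zero {z δ : E} (h : (inner ℂ z δ).re = 0) :
    ‖z + δ‖ ^ 2 = ‖z‖ ^ 2 + ‖δ‖ ^ 2 := by
  rw [@norm_add_sq ℂ, RCLike.re_eq_complex_re, h]; ring

theorem norm_smul_add_smul_sq {z δ : E} (h : (inner ℂ z δ).re = 0) (a b : ℝ) :
    ‖a • z + b • δ‖ ^ 2 = a ^ 2 * ‖z‖ ^ 2 + b ^ 2 * ‖δ‖ ^ 2 := by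
  have : (inner ℂ (a • z) (b • δ)).re = 0 := by
    rw [← Complex.coe_smul, ← Complex.coe_smul, inner_smul_left, inner_smul_right,
      Complex.conj_ofReal, Complex.re_ofReal_mul, Complex.re_ofReal_mul, h]; simp
  rw [norm_add_sq_of_inner_eq_zero this, norm_smul, norm_smul, mul_pow, mul_pow]
  simp

/-- The Lagrange condition for `‖f‖` on a sphere. -/
theorem re_inner_fderiv_eq_zero_of_isExtrOn {f : E → F} {J : E →L[ℂ] F} {z : E}
    (hz0 : z ≠ 0) (hf : HasFDerivAt f J z) (hext : IsExtrOn (fun ξ => ‖f ξ‖) (sphere 0 ‖z‖) z)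
    {τ : E} (hτ : (inner ℂ z τ).re = 0) : (inner ℂ (f z) (J τ)).re = 0 := by
  rcases eq_or_ne τ 0 with rfl | hτ0
  · simp
  have hn : 0 < ‖τ‖ := norm_pos_iff.2 hτ0
  -- Rescaling `τ` to length `‖z‖` makes the curve `g` below a great circle through `z`.
  set k : ℝ := ‖z‖ / ‖τ‖ with hk
  have hk0 : 0 < k := div_pos (norm_pos_iff.2 hz0) hn
  set g : ℝ → E := fun t => Real.cos t • z + Real.sin t • (k • τ) with hg
  have hg0 : g 0 = z := by simp [hg]
  have hgd : HasDerivAt g (k • τ) 0 := by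
    have := ((Real.hasDerivAt_cos 0).smul_const z).add
      ((Real.hasDerivAt_sin 0).smul_const (k • τ))
    simp only [neg_zero, Real.sin_zero, zero_smul, Real.cos_zero, one_smul, zero_add] at this
    exact this
  have hgs : ∀ t, g t ∈ sphere (0 : E) ‖z‖ := fun t => by
    rw [mem_sphere_zero_iff_norm, ← sq_eq_sq₀ (norm_nonneg _) (norm_nonneg _)]
    simp only [hg, smul_smul]
    rw [norm_smul_add_smul_sq hτ, mul_pow, mul_assoc, ← mul_pow k, hk, div_mul_cancel₀ _ hn.ne',
      ← add_mul, Real.cos_sq_add_sin_sq, one_mul]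
  have hd : HasDerivAt (fun t => ‖f (g t)‖ ^ 2) (2 * (inner ℂ (f (g 0)) (J (k • τ))).re) 0 :=
    hasDerivAt_norm_sq_of_complex (HasFDerivAt.comp_hasDerivAt_real (by rwa [hg0]) hgd)
  have hloc : IsLocalExtr (fun t => ‖f (g t)‖ ^ 2) 0 := by
    rcases hext with h | h
    · left
      refine Eventually.of_forall fun t => ?_
      have := h (hgs t)
      simp only [mem_ofPred_eq] at this
      simp only [hg0]
      gcongr
    · right
      refine Eventually.of_forall fun t => ?_
      have := h (hgs t)
      simp only [mem_ofPred_eq] at this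
      simp only [hg0]
      gcongr
  have := hloc.hasDerivAt_eq_zero hd
  rw [hg0, ← Complex.coe_smul, map_smul, inner_smul_right, Complex.re_ofReal_mul] at this
  simpa [hk0.ne'] using this

theorem inner_fderiv_eq_zero_of_isExtrOn {f : E → F} {J : E →L[ℂ] F} {z : E}
    (hz0 : z ≠ 0) (hf : HasFDerivAt f J z) (hext : IsExtrOn (fun ξ => ‖f ξ‖) (sphere 0 ‖z‖) z)
    {δ : E} (hδ : inner ℂ z δ = 0) : inner ℂ (f z) (J δ) = 0 := by
  have h1 := re_inner_fderiv_eq_zero_of_isExtrOn hz0 hf hext (τ := δ) (by rw [hδ]; rfl)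
  -- The holomorphic tangent space is complex: testing `I • δ` gives the imaginary part.
  have h2 := re_inner_fderiv_eq_zero_of_isExtrOn hz0 hf hext (τ := Complex.I • δ)
    (by rw [inner_smul_right, hδ, mul_zero, Complex.zero_re])
  rw [map_smul, inner_smul_right] at h2
  apply Complex.ext
  · simpa using h1
  · simpa using h2

theorem im_inner_fderiv_self_eq_zero_of_isExtrOn {f : E → F} {J : E →L[ℂ] F} {z : E}
    (hz0 : z ≠ 0) (hf : HasFDerivAt f J z) (hext : IsExtrOn (fun ξ => ‖f ξ‖) (sphere 0 ‖z‖) z) :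
    (inner ℂ (f z) (J z)).im = 0 := by
  have h2 := re_inner_fderiv_eq_zero_of_isExtrOn hz0 hf hext (τ := Complex.I • z) (by
    rw [inner_smul_right, inner_self_eq_norm_sq_to_K]
    simp [← Complex.ofReal_pow])
  rw [map_smul, inner_smul_right] at h2
  simpa using h2

/-- If `J v = f z` then `⟨v, z⟩ / ‖z‖ ^ 2` is the inverse of the logarithmic radial derivative of
`‖f‖` at `z`. -/
theorem inner_mul_inner_of_isExtrOn {f : E → F} {J : E →L[ℂ] F} {z v : E} (hz0 : z ≠ 0)
    (hf : HasFDerivAt f J z) (hext : IsExtrOn (fun ξ => ‖f ξ‖) (sphere 0 ‖z‖) z)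
    (hv : J v = f z) :
    inner ℂ z v / (‖z‖ : ℂ) ^ 2 * inner ℂ (f z) (J z) = (‖f z‖ : ℂ) ^ 2 := by
  set c : ℂ := inner ℂ z v / (‖z‖ : ℂ) ^ 2 with hc
  have hz' : (‖z‖ : ℂ) ^ 2 ≠ 0 := by simpa using hz0
  -- The component of `v` orthogonal to `z` is tangent, so its image `f z - c • J z` is orthogonal
  -- to `f z`.
  have h0 : inner ℂ z (v - c • z) = 0 := by
    rw [inner_sub_right, inner_smul_right, inner_self_eq_norm_sq_to_K, hc]
    simp only [Complex.coe_algebraMap]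
    rw [div_mul_cancel₀ _ hz', sub_self]
  have := inner_fderiv_eq_zero_of_isExtrOn hz0 hf hext h0
  rw [map_sub, map_smul, hv, inner_sub_right, inner_smul_right, inner_self_eq_norm_sq_to_K,
    sub_eq_zero] at this
  exact this.symm

/-- The restriction of `f` to the disc centred at `s • z` in the direction `δ` whose boundary lies on
the sphere of radius `‖z‖`, when `δ` is orthogonal to `z` and `‖δ‖ = ‖z‖`. -/
noncomputable def tangentDisc (f : E → F) (z δ : E) (s : ℝ) (ζ : ℂ) : F :=
  f ((s : ℂ) • z + ((√(1 - s ^ 2) : ℂ) * ζ) • δ)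

theorem norm_tangentDisc_arg_sq {z δ : E} (hδ : inner ℂ z δ = 0) (hn : ‖δ‖ = ‖z‖) {s : ℝ}
    (hs : s ∈ Ioo (0 : ℝ) 1) (ζ : ℂ) :
    ‖(s : ℂ) • z + ((√(1 - s ^ 2) : ℂ) * ζ) • δ‖ ^ 2 =
      (s ^ 2 + (1 - s ^ 2) * ‖ζ‖ ^ 2) * ‖z‖ ^ 2 := by
  have h1 : 0 ≤ 1 - s ^ 2 := by nlinarith [hs.1, hs.2]
  rw [norm_add_sq_of_inner_eq_zero (by rw [inner_smul_left, inner_smul_right, hδ]; simp),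
    norm_smul, norm_smul, norm_mul, hn, Complex.norm_real, Complex.norm_real, mul_pow, mul_pow,
    mul_pow, Real.norm_eq_abs, Real.norm_eq_abs, sq_abs, sq_abs, Real.sq_sqrt h1]
  ring

theorem tangentDisc_arg_mem_sphere {z δ : E} (hδ : inner ℂ z δ = 0) (hn : ‖δ‖ = ‖z‖) {s : ℝ}
    (hs : s ∈ Ioo (0 : ℝ) 1) {ζ : ℂ} (hζ : ‖ζ‖ = 1) :
    (s : ℂ) • z + ((√(1 - s ^ 2) : ℂ) * ζ) • δ ∈ sphere (0 : E) ‖z‖ := by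
  rw [mem_sphere_zero_iff_norm, ← sq_eq_sq₀ (norm_nonneg _) (norm_nonneg _),
    norm_tangentDisc_arg_sq hδ hn hs, hζ]
  ring

theorem differentiableOn_tangentDisc {f : E → F} {z δ : E}
    (hf : DifferentiableOn ℂ f (ball 0 1)) (hz : ‖z‖ < 1) (hδ : inner ℂ z δ = 0)
    (hn : ‖δ‖ = ‖z‖) {s : ℝ} (hs : s ∈ Ioo (0 : ℝ) 1) :
    DifferentiableOn ℂ (tangentDisc f z δ s) (closedBall 0 1) := by
  refine hf.comp (by fun_prop) fun ζ hζ => ?_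
  rw [mem_closedBall_zero_iff] at hζ
  rw [mem_ball_zero_iff]
  refine lt_of_le_of_lt ?_ hz
  rw [← sq_le_sq₀ (norm_nonneg _) (norm_nonneg _), norm_tangentDisc_arg_sq hδ hn hs]
  have h1 : 0 ≤ 1 - s ^ 2 := by nlinarith [hs.1, hs.2]
  have h2 : ‖ζ‖ ^ 2 ≤ 1 := pow_le_one₀ (norm_nonneg _) hζ
  have h3 : s ^ 2 + (1 - s ^ 2) * ‖ζ‖ ^ 2 ≤ 1 := by nlinarith
  nlinarith [sq_nonneg ‖z‖]

theorem eventually_mem_Ioo_nhdsLT_one : ∀ᶠ s in 𝓝[<] (1 : ℝ), s ∈ Ioo (0 : ℝ) 1 :=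
  Ioo_mem_nhdsLT one_pos

theorem one_sub_le_sqrt_one_sub_sq {s : ℝ} (hs : s ∈ Ioo (0 : ℝ) 1) : 1 - s ≤ √(1 - s ^ 2) := by
  apply Real.le_sqrt_of_sq_le
  nlinarith [hs.1, hs.2]

/-- Differentiability at `z` suffices: the centre and the boundary of the disc are both `O(√(1 -
s²))` from `z`, and the linearization of `f` is exactly affine in `ζ`. -/
theorem eventually_norm_tangentDisc_sub_le {f : E → F} {J : E →L[ℂ] F} {z δ : E} (hz0 : z ≠ 0)
    (hf : HasFDerivAt f J z) (hn : ‖δ‖ = ‖z‖) {c : ℝ} (hc : 0 < c) :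
    ∀ᶠ s in 𝓝[<] (1 : ℝ), ∀ ζ : ℂ, ‖ζ‖ = 1 →
      ‖tangentDisc f z δ s ζ - tangentDisc f z δ s 0 - ζ • ((√(1 - s ^ 2) : ℂ) • J δ)‖ ≤
        c * √(1 - s ^ 2) := by
  have hr : 0 < ‖z‖ := norm_pos_iff.2 hz0
  -- The factor 3 is 2 + 1: the boundary point is within `2 * ‖z‖ * t` of `z` and the centre within
  -- `‖z‖ * t`, where `t = √(1 - s²)`.
  have h1 := hf.isLittleO.bound (c := c / (3 * ‖z‖)) (by positivity)
  obtain ⟨ρ, hρ, hball⟩ := Metric.eventually_nhds_iff.1 h1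
  have ht : Tendsto (fun s : ℝ => 2 * ‖z‖ * √(1 - s ^ 2)) (𝓝[<] 1) (𝓝 0) := by
    have : ContinuousAt (fun s : ℝ => 2 * ‖z‖ * √(1 - s ^ 2)) 1 := by fun_prop
    have := this.tendsto.mono_left (nhdsWithin_le_nhds (s := Iio 1))
    simpa using this
  filter_upwards [eventually_mem_Ioo_nhdsLT_one, ht.eventually_lt_const hρ] with s hs hsρ ζ hζ
  set t : ℝ := √(1 - s ^ 2) with htdef
  have hst := one_sub_le_sqrt_one_sub_sq hs
  rw [← htdef] at hst
  have ht0 : 0 ≤ t := Real.sqrt_nonneg _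
  have e1 : ‖((s : ℂ) - 1) • z‖ ≤ t * ‖z‖ := by
    rw [norm_smul, ← Complex.ofReal_one, ← Complex.ofReal_sub, Complex.norm_real,
      Real.norm_eq_abs, abs_of_nonpos (by linarith [hs.2])]
    gcongr
    linarith
  have e2 : ‖((t : ℂ) * ζ) • δ‖ = t * ‖z‖ := by
    rw [norm_smul, norm_mul, hζ, hn, Complex.norm_real, Real.norm_eq_abs, abs_of_nonneg ht0]; ring
  have d1 : (s : ℂ) • z + ((t : ℂ) * ζ) • δ - z = ((s : ℂ) - 1) • z + ((t : ℂ) * ζ) • δ := by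
    rw [sub_smul, one_smul]; abel
  have d2 : (s : ℂ) • z + ((t : ℂ) * 0) • δ - z = ((s : ℂ) - 1) • z := by
    rw [sub_smul, one_smul]; simp
  have n1 : ‖(s : ℂ) • z + ((t : ℂ) * ζ) • δ - z‖ ≤ 2 * ‖z‖ * t := by
    rw [d1]; refine (norm_add_le _ _).trans ?_; linarith
  have n2 : ‖(s : ℂ) • z + ((t : ℂ) * 0) • δ - z‖ ≤ t * ‖z‖ := by rwa [d2]
  have n2' : t * ‖z‖ ≤ 2 * ‖z‖ * t := by nlinarith [mul_nonneg ht0 hr.le]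
  have b1 := hball (y := (s : ℂ) • z + ((t : ℂ) * ζ) • δ)
    (by rw [dist_eq_norm]; linarith)
  have b2 := hball (y := (s : ℂ) • z + ((t : ℂ) * 0) • δ)
    (by rw [dist_eq_norm]; linarith)
  have key : tangentDisc f z δ s ζ - tangentDisc f z δ s 0 - ζ • ((t : ℂ) • J δ) =
      (f ((s : ℂ) • z + ((t : ℂ) * ζ) • δ) - f z - J ((s : ℂ) • z + ((t : ℂ) * ζ) • δ - z)) -
      (f ((s : ℂ) • z + ((t : ℂ) * 0) • δ) - f z -
        J ((s : ℂ) • z + ((t : ℂ) * 0) • δ - z)) := by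
    rw [d1, d2]
    simp only [tangentDisc, map_add, map_smul, smul_smul, mul_comm ζ, ← htdef]
    abel
  rw [key]
  refine (norm_sub_le _ _).trans ((add_le_add b1 b2).trans ?_)
  have : c / (3 * ‖z‖) * (2 * ‖z‖ * t) + c / (3 * ‖z‖) * (t * ‖z‖) = c * t := by
    field_simp; ring
  rw [← this]
  gcongr

/-- The centre value is `f (s • z)`, so this is the radial difference quotient of `‖f‖²` divided by
`1 + s → 2`. -/
theorem tendsto_norm_sq_sub_div {f : E → F} {J : E →L[ℂ] F} {z δ : E}
    (hf : HasFDerivAt f J z) :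
    Tendsto (fun s : ℝ => (‖f z‖ ^ 2 - ‖tangentDisc f z δ s 0‖ ^ 2) / (1 - s ^ 2)) (𝓝[<] 1)
      (𝓝 (inner ℂ (f z) (J z)).re) := by
  have hg : HasDerivAt (fun s : ℝ => s • z) z 1 := by
    simpa using (hasDerivAt_id (1 : ℝ)).smul_const z
  have hd := hasDerivAt_norm_sq_of_complex
    (HasFDerivAt.comp_hasDerivAt_real (f := f) (J := J) (by simpa using hf) hg)
  have h1 := (hasDerivAt_iff_tendsto_slope.1 hd).mono_left
    (nhdsWithin_mono 1 (fun s (hs : s < 1) => hs.ne))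
  have h2 : Tendsto (fun s : ℝ => (1 + s)⁻¹) (𝓝[<] 1) (𝓝 (1 + 1)⁻¹) := by
    refine Tendsto.mono_left (ContinuousAt.tendsto ?_) nhdsWithin_le_nhds
    fun_prop (disch := norm_num)
  have h3 := h1.mul h2
  have e : 2 * (inner ℂ (f ((1 : ℝ) • z)) (J z)).re * (1 + 1)⁻¹ = (inner ℂ (f z) (J z)).re := by
    rw [one_smul]; ring
  rw [e] at h3
  refine h3.congr' ?_
  filter_upwards [eventually_mem_Ioo_nhdsLT_one] with s hs
  have e1 : (1 : ℝ) - s ≠ 0 := by linarith [hs.2]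
  have e2 : (1 : ℝ) + s ≠ 0 := by linarith [hs.1]
  have e3 : s - 1 ≠ 0 := by linarith [hs.2]
  have e4 : 1 - s ^ 2 ≠ 0 := by
    have := mul_ne_zero e1 e2
    contrapose! this
    linear_combination this
  rw [slope_def_field]
  simp only [tangentDisc, mul_zero, zero_smul, add_zero, one_smul, Complex.coe_smul]
  field_simp
  ring

theorem tendsto_norm_deriv_tangentDisc_sq {f : E → F} {J : E →L[ℂ] F} {z δ : E} (hz0 : z ≠ 0)
    (hfd : DifferentiableOn ℂ f (ball 0 1)) (hz : ‖z‖ < 1)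
    (hf : HasFDerivAt f J z) (hδ : inner ℂ z δ = 0) (hn : ‖δ‖ = ‖z‖) :
    Tendsto (fun s : ℝ => ‖deriv (tangentDisc f z δ s) 0‖ ^ 2 / (1 - s ^ 2)) (𝓝[<] 1)
      (𝓝 (‖J δ‖ ^ 2)) := by
  have h1 : Tendsto (fun s : ℝ => ‖deriv (tangentDisc f z δ s) 0‖ / √(1 - s ^ 2)) (𝓝[<] 1)
      (𝓝 ‖J δ‖) := by
    rw [Metric.tendsto_nhds]
    intro c hc
    filter_upwards [eventually_mem_Ioo_nhdsLT_one,
      eventually_norm_tangentDisc_sub_le hz0 hf hn (half_pos hc)] with s hs hb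
    have ht : 0 < √(1 - s ^ 2) := Real.sqrt_pos.2 (by nlinarith [hs.1, hs.2])
    have h2 := norm_deriv_sub_le (differentiableOn_tangentDisc hfd hz hδ hn hs) hb
    have h3 := (abs_norm_sub_norm_le _ _).trans h2
    rw [norm_smul, Complex.norm_real, Real.norm_eq_abs, abs_of_pos ht] at h3
    rw [Real.dist_eq]
    have h4 : ‖deriv (tangentDisc f z δ s) 0‖ / √(1 - s ^ 2) - ‖J δ‖ =
        (‖deriv (tangentDisc f z δ s) 0‖ - √(1 - s ^ 2) * ‖J δ‖) / √(1 - s ^ 2) := by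
      field_simp
    rw [h4, abs_div, abs_of_pos ht, div_lt_iff₀ ht]
    nlinarith
  refine (h1.pow 2).congr' ?_
  filter_upwards [eventually_mem_Ioo_nhdsLT_one] with s hs
  rw [div_pow, Real.sq_sqrt (by nlinarith [hs.1, hs.2])]

theorem norm_fderiv_sq_le_of_isMaxOn [CompleteSpace F] {f : E → F} {J : E →L[ℂ] F} {z δ : E} (hz0 : z ≠ 0)
    (hfd : DifferentiableOn ℂ f (ball 0 1)) (hz : ‖z‖ < 1) (hf : HasFDerivAt f J z)
    (hmax : IsMaxOn (fun ξ => ‖f ξ‖) (sphere 0 ‖z‖) z)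
    (hδ : inner ℂ z δ = 0) (hn : ‖δ‖ = ‖z‖) : ‖J δ‖ ^ 2 ≤ (inner ℂ (f z) (J z)).re := by
  refine le_of_tendsto_of_tendsto (tendsto_norm_deriv_tangentDisc_sq hz0 hfd hz hf hδ hn)
    (tendsto_norm_sq_sub_div (δ := δ) hf) ?_
  filter_upwards [eventually_mem_Ioo_nhdsLT_one] with s hs
  have h1 : 0 < 1 - s ^ 2 := by nlinarith [hs.1, hs.2]
  gcongr
  have := norm_sq_add_norm_deriv_sq_le (differentiableOn_tangentDisc hfd hz hδ hn hs)
    (R := ‖f z‖) (fun ζ hζ => hmax (tangentDisc_arg_mem_sphere hδ hn hs hζ))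
  linarith

theorem le_norm_fderiv_sq_of_isMinOn [CompleteSpace F] {f : E → F} {J : E →L[ℂ] F} {z δ : E} (hz0 : z ≠ 0)
    (hfd : DifferentiableOn ℂ f (ball 0 1)) (hz : ‖z‖ < 1) (hf : HasFDerivAt f J z)
    (hmin : IsMinOn (fun ξ => ‖f ξ‖) (sphere 0 ‖z‖) z)
    (hδ : inner ℂ z δ = 0) (hn : ‖δ‖ = ‖z‖) : (inner ℂ (f z) (J z)).re ≤ ‖J δ‖ ^ 2 := by
  have main : ∀ c : ℝ, 0 < c → (inner ℂ (f z) (J z)).re - (2 * c) ^ 2 ≤ ‖J δ‖ ^ 2 := by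
    intro c hc
    refine le_of_tendsto_of_tendsto ((tendsto_norm_sq_sub_div (δ := δ) hf).sub_const ((2 * c) ^ 2))
      (tendsto_norm_deriv_tangentDisc_sq hz0 hfd hz hf hδ hn) ?_
    filter_upwards [eventually_mem_Ioo_nhdsLT_one,
      eventually_norm_tangentDisc_sub_le hz0 hf hn hc] with s hs hb
    have h1 : 0 < 1 - s ^ 2 := by nlinarith [hs.1, hs.2]
    have hd := differentiableOn_tangentDisc hfd hz hδ hn hs
    have h2 := norm_deriv_sub_le hd hb
    have := le_norm_sq_add_norm_deriv_sq hd (R := ‖f z‖) (norm_nonneg _)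
      (fun ζ hζ => hmin (tangentDisc_arg_mem_sphere hδ hn hs hζ))
      -- One `c` bounds the deviation from the model slope `√(1 - s²) • J δ`; the other, by Cauchy's
      -- estimate, pays for replacing that slope by the true derivative.
      (η := 2 * c * √(1 - s ^ 2)) (fun ζ hζ => by
        set G := tangentDisc f z δ s
        have e : G ζ - G 0 - ζ • deriv G 0 = (G ζ - G 0 - ζ • ((√(1 - s ^ 2) : ℂ) • J δ)) -
            ζ • (deriv G 0 - (√(1 - s ^ 2) : ℂ) • J δ) := by
          rw [smul_sub]; abel
        rw [e]
        refine (norm_sub_le _ _).trans ?_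
        rw [norm_smul, hζ, one_mul]
        linarith [hb ζ hζ])
    rw [mul_pow, Real.sq_sqrt h1.le] at this
    rw [div_sub' h1.ne', div_le_div_iff_of_pos_right h1]
    linarith
  have ht : Tendsto (fun c : ℝ => (inner ℂ (f z) (J z)).re - (2 * c) ^ 2) (𝓝[>] 0)
      (𝓝 (inner ℂ (f z) (J z)).re) := by
    have : ContinuousAt (fun c : ℝ => (inner ℂ (f z) (J z)).re - (2 * c) ^ 2) 0 := by fun_prop
    have := this.tendsto.mono_left (nhdsWithin_le_nhds (s := Ioi 0))
    simpa using this
  exact le_of_tendsto ht (by filter_upwards [self_mem_nhdsWithin] with c hc using main c hc)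

end Sphere

/-! ### The Möbius function `orderFun` and the Schwarz lemma -/

namespace StarlikeDistortion

theorem orderFun_zero (γ : ℝ) : orderFun γ 0 = 1 := by simp [orderFun]

theorem abs_one_sub_two_mul_lt {γ : ℝ} (hγ0 : 0 < γ) (hγ1 : γ < 1) : |1 - 2 * γ| < 1 := by
  rw [abs_lt]; constructor <;> linarith

theorem one_add_mul_ne_zero {γ : ℝ} (hγ0 : 0 < γ) (hγ1 : γ < 1) {ζ : ℂ} (hζ : ‖ζ‖ < 1) :
    1 + (1 - 2 * (γ : ℂ)) * ζ ≠ 0 := by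
  intro h
  have h1 : (1 - 2 * (γ : ℂ)) * ζ = -1 := by linear_combination h
  have h2 := congrArg norm h1
  have h3 : ‖(1 - 2 * (γ : ℂ))‖ = |1 - 2 * γ| := by
    rw [← Real.norm_eq_abs, ← Complex.norm_real]; push_cast; rfl
  rw [norm_mul, norm_neg, norm_one, h3] at h2
  have := abs_one_sub_two_mul_lt hγ0 hγ1
  nlinarith [norm_nonneg ζ, abs_nonneg (1 - 2 * γ)]

theorem one_add_mul_orderFun {γ : ℝ} (hγ0 : 0 < γ) (hγ1 : γ < 1) {ζ : ℂ} (hζ : ‖ζ‖ < 1) :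
    1 + (1 - 2 * (γ : ℂ)) * orderFun γ ζ = 2 * (1 - γ) / (1 + (1 - 2 * (γ : ℂ)) * ζ) := by
  have := one_add_mul_ne_zero hγ0 hγ1 hζ
  rw [orderFun]
  field_simp
  ring

theorem one_add_mul_orderFun_ne_zero {γ : ℝ} (hγ0 : 0 < γ) (hγ1 : γ < 1) {ζ : ℂ}
    (hζ : ‖ζ‖ < 1) : 1 + (1 - 2 * (γ : ℂ)) * orderFun γ ζ ≠ 0 := by
  rw [one_add_mul_orderFun hγ0 hγ1 hζ]
  have h1 := one_add_mul_ne_zero hγ0 hγ1 hζ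
  have h2 : (1 - (γ : ℂ)) ≠ 0 := by
    rw [sub_ne_zero]; exact_mod_cast hγ1.ne'
  exact div_ne_zero (mul_ne_zero two_ne_zero h2) h1

/-- The Möbius transformation `orderFun γ` is an involution. -/
theorem orderFun_orderFun {γ : ℝ} (hγ0 : 0 < γ) (hγ1 : γ < 1) {ζ : ℂ} (hζ : ‖ζ‖ < 1) :
    orderFun γ (orderFun γ ζ) = ζ := by
  have h1 := one_add_mul_ne_zero hγ0 hγ1 hζ
  rw [orderFun, div_eq_iff (one_add_mul_orderFun_ne_zero hγ0 hγ1 hζ),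
    one_add_mul_orderFun hγ0 hγ1 hζ, orderFun, one_sub_div h1, mul_div_assoc']
  congr 1
  ring

/-- As `orderFun γ` is its own inverse, `orderFun γ ∘ p` is a holomorphic map of the disc into
itself fixing 0, and the Schwarz lemma applies. -/
theorem exists_norm_le_orderFun_eq {γ : ℝ} (hγ0 : 0 < γ) (hγ1 : γ < 1) {p : ℂ → ℂ}
    (hp : DifferentiableOn ℂ p (ball 0 1)) (hp0 : p 0 = 1)
    (hpim : ∀ ζ ∈ ball (0 : ℂ) 1, p ζ ∈ orderFun γ '' ball (0 : ℂ) 1) {ζ : ℂ}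
    (hζ : ζ ∈ ball (0 : ℂ) 1) : ∃ η : ℂ, ‖η‖ ≤ ‖ζ‖ ∧ p ζ = orderFun γ η := by
  have hω : ∀ ζ ∈ ball (0 : ℂ) 1, orderFun γ (p ζ) ∈ ball (0 : ℂ) 1 ∧
      p ζ = orderFun γ (orderFun γ (p ζ)) ∧ 1 + (1 - 2 * (γ : ℂ)) * p ζ ≠ 0 := by
    intro ζ hζ
    obtain ⟨η, hη, he⟩ := hpim ζ hζ
    have hη' := mem_ball_zero_iff.1 hη
    rw [← he, orderFun_orderFun hγ0 hγ1 hη']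
    exact ⟨hη, rfl, one_add_mul_orderFun_ne_zero hγ0 hγ1 hη'⟩
  refine ⟨orderFun γ (p ζ), ?_, (hω ζ hζ).2.1⟩
  have hd : DifferentiableOn ℂ (fun ζ => orderFun γ (p ζ)) (ball 0 1) := by
    unfold orderFun
    exact ((differentiableOn_const 1).sub hp).div
      ((differentiableOn_const 1).add ((differentiableOn_const _).mul hp))
      fun ζ hζ => (hω ζ hζ).2.2
  exact Complex.norm_le_norm_of_mapsTo_ball hd (fun ζ hζ => ball_subset_closedBall (hω ζ hζ).1)
    (by simp [hp0, orderFun]) (mem_ball_zero_iff.1 hζ)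

/-- On the slice `ζ • u` with `u = z / ‖z‖`, the quotient in `MemM` equals `⟨h (ζ • u), u⟩ / ζ`,
which `dslope` extends holomorphically to 0 with value 1. -/
theorem MemM.exists_norm_le {n : ℕ} {γ : ℝ} (hγ0 : 0 < γ) (hγ1 : γ < 1) {h : Cn n → Cn n}
    (hh : MemM (orderFun γ) h) {z : Cn n} (hz : z ∈ unitBall n) (hz0 : z ≠ 0) :
    ∃ η : ℂ, ‖η‖ ≤ ‖z‖ ∧ inner ℂ z (h z) / (‖z‖ : ℂ) ^ 2 = orderFun γ η := by
  have hr : 0 < ‖z‖ := norm_pos_iff.2 hz0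
  have hr1 : ‖z‖ < 1 := mem_ball_zero_iff.1 hz
  set u : Cn n := (‖z‖ : ℂ)⁻¹ • z with hu
  have hun : ‖u‖ = 1 := by
    rw [hu, norm_smul, norm_inv, Complex.norm_real, norm_norm, inv_mul_cancel₀ hr.ne']
  have hzu : (‖z‖ : ℂ) • u = z := by
    rw [hu, smul_smul, mul_inv_cancel₀ (by exact_mod_cast hr.ne'), one_smul]
  have hmaps : MapsTo (fun ζ : ℂ => ζ • u) (ball 0 1) (unitBall n) := fun ζ hζ => by
    rw [unitBall, mem_ball_zero_iff, norm_smul, hun, mul_one]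
    exact mem_ball_zero_iff.1 hζ
  set φ : ℂ → ℂ := fun ζ => inner ℂ u (h (ζ • u)) with hφ
  have hφd : DifferentiableOn ℂ φ (ball 0 1) :=
    (innerSL ℂ u).differentiable.comp_differentiableOn
      (hh.normalized.holomorphic.comp (by fun_prop) hmaps)
  have hp := (Complex.differentiableOn_dslope (ball_mem_nhds (0 : ℂ) one_pos)).2 hφd
  have hh0 : HasFDerivAt h (ContinuousLinearMap.id ℂ (Cn n)) ((0 : ℂ) • u) := by
    rw [zero_smul, ← hh.normalized.jacobian_zero]
    exact (hh.normalized.holomorphic.differentiableAt (ball_mem_nhds _ one_pos)).hasFDerivAt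
  have hp0 : dslope φ 0 0 = 1 := by
    have h1 : HasDerivAt (fun ζ : ℂ => ζ • u) u 0 := by
      simpa using (hasDerivAt_id (0 : ℂ)).smul_const u
    have h2 : HasDerivAt φ (innerSL ℂ u (ContinuousLinearMap.id ℂ (Cn n) u)) 0 :=
      (innerSL ℂ u).hasFDerivAt.comp_hasDerivAt (0 : ℂ) (hh0.comp_hasDerivAt (0 : ℂ) h1)
    rw [dslope_same, h2.deriv]
    simp [hun]
  have hpe : ∀ ζ : ℂ, ζ ≠ 0 →
      dslope φ 0 ζ = inner ℂ (ζ • u) (h (ζ • u)) / ((‖ζ • u‖ : ℝ) : ℂ) ^ 2 := by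
    intro ζ hζ
    have hc : (starRingEnd ℂ) ζ ≠ 0 := by simpa using hζ
    rw [dslope_of_ne _ hζ, slope_def_field, norm_smul, hun, mul_one, inner_smul_left,
      ← Complex.ofReal_pow, ← Complex.normSq_eq_norm_sq, ← Complex.mul_conj]
    have : φ 0 = 0 := by simp [hφ, hh.normalized.map_zero]
    rw [this, sub_zero, sub_zero]
    simp only [hφ]
    field_simp
  obtain ⟨η, hη, he⟩ := exists_norm_le_orderFun_eq hγ0 hγ1 hp hp0 (fun ζ hζ => by
    rcases eq_or_ne ζ 0 with rfl | hζ0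
    · exact ⟨0, by simp, by rw [hp0, orderFun_zero]⟩
    · rw [hpe ζ hζ0]
      refine hh.mem_image _ (hmaps hζ) (smul_ne_zero hζ0 ?_)
      rw [← norm_pos_iff, hun]
      exact one_pos) (ζ := (‖z‖ : ℂ)) (by simpa using hr1)
  refine ⟨η, by simpa using hη, ?_⟩
  rw [← he, hpe _ (by exact_mod_cast hr.ne'), hzu]

theorem orderFun_real_bounds {γ : ℝ} (hγ0 : 0 < γ) (hγ1 : γ < 1) {r c : ℝ} (hr1 : r < 1) {η : ℂ}
    (hη : ‖η‖ ≤ r) (hc : (c : ℂ) = orderFun γ η) :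
    (1 - r) / (1 + (1 - 2 * γ) * r) ≤ c ∧ c ≤ (1 + r) / (1 - (1 - 2 * γ) * r) := by
  have hη1 := hη.trans_lt hr1
  -- The involution has real coefficients, so a real value `c` forces `η` real; on `[-r, r]` the
  -- function is decreasing.
  obtain ⟨x, rfl⟩ : ∃ x : ℝ, η = x := by
    refine ⟨(1 - c) / (1 + (1 - 2 * γ) * c), ?_⟩
    rw [← orderFun_orderFun hγ0 hγ1 hη1, ← hc, orderFun]
    push_cast
    rfl
  rw [Complex.norm_real, Real.norm_eq_abs] at hη
  obtain ⟨hx1, hx2⟩ := abs_le.1 hη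
  have hcx : c = (1 - x) / (1 + (1 - 2 * γ) * x) := by
    rw [orderFun] at hc
    exact_mod_cast hc
  have p1 : 0 < 1 + (1 - 2 * γ) * x := by nlinarith
  have p2 : 0 < 1 + (1 - 2 * γ) * r := by nlinarith
  have p3 : 0 < 1 - (1 - 2 * γ) * r := by nlinarith
  rw [hcx]
  constructor
  · rw [div_le_div_iff₀ p2 p1]; nlinarith
  · rw [div_le_div_iff₀ p1 p3]; nlinarith

end StarlikeDistortion

/-! ### Determinant bounds from norm bounds -/

section Det

theorem Multiset.norm_prod_le_pow_card {s : Multiset ℂ} {m : ℝ} (h : ∀ x ∈ s, ‖x‖ ≤ m) :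
    ‖s.prod‖ ≤ m ^ s.card := by
  induction s using Multiset.induction with
  | empty => simp
  | cons a s ih =>
    have ha := h a (Multiset.mem_cons_self a s)
    rw [Multiset.prod_cons, Multiset.card_cons, norm_mul, pow_succ']
    exact mul_le_mul ha (ih fun x hx => h x (Multiset.mem_cons_of_mem hx)) (norm_nonneg _)
      ((norm_nonneg _).trans ha)

theorem Multiset.pow_card_le_norm_prod {s : Multiset ℂ} {m : ℝ} (hm : 0 ≤ m)
    (h : ∀ x ∈ s, m ≤ ‖x‖) : m ^ s.card ≤ ‖s.prod‖ := by
  induction s using Multiset.induction with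
  | empty => simp
  | cons a s ih =>
    have ha := h a (Multiset.mem_cons_self a s)
    rw [Multiset.prod_cons, Multiset.card_cons, norm_mul, pow_succ']
    exact mul_le_mul ha (ih fun x hx => h x (Multiset.mem_cons_of_mem hx)) (pow_nonneg hm _)
      (norm_nonneg _)

variable {E : Type*} [NormedAddCommGroup E] [InnerProductSpace ℂ E] [FiniteDimensional ℂ E]

theorem LinearMap.det_eq_prod_roots_charpoly (T : E →ₗ[ℂ] E) :
    LinearMap.det T = T.charpoly.roots.prod := by
  classical
  rw [← LinearMap.det_toMatrix (Module.finBasis ℂ E), Matrix.det_eq_prod_roots_charpoly,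
    LinearMap.charpoly_toMatrix]

theorem LinearMap.card_roots_charpoly (T : E →ₗ[ℂ] E) :
    T.charpoly.roots.card = Module.finrank ℂ E := by
  rw [← T.charpoly_natDegree]
  exact (IsAlgClosed.splits T.charpoly).natDegree_eq_card_roots.symm

theorem LinearMap.exists_norm_eq_of_mem_roots_charpoly {T : E →ₗ[ℂ] E} {μ : ℂ}
    (hμ : μ ∈ T.charpoly.roots) : ∃ x : E, 0 < ‖x‖ ∧ ‖T x‖ = ‖μ‖ * ‖x‖ := by
  have := (Module.End.hasEigenvalue_iff_isRoot_charpoly T μ).2 (Polynomial.isRoot_of_mem_roots hμ)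
  obtain ⟨x, hx⟩ := this.exists_hasEigenvector
  exact ⟨x, norm_pos_iff.2 hx.2, by rw [hx.apply_eq_smul, norm_smul]⟩

/-- The determinant is the product of the eigenvalues, and the modulus of each is a ratio `‖T x‖ /
‖x‖`. -/
theorem LinearMap.norm_det_le_pow {T : E →ₗ[ℂ] E} {m : ℝ} (h : ∀ x, ‖T x‖ ≤ m * ‖x‖) :
    ‖LinearMap.det T‖ ≤ m ^ Module.finrank ℂ E := by
  rw [T.det_eq_prod_roots_charpoly, ← T.card_roots_charpoly]
  refine Multiset.norm_prod_le_pow_card fun μ hμ => ?_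
  obtain ⟨x, hx, he⟩ := LinearMap.exists_norm_eq_of_mem_roots_charpoly hμ
  exact le_of_mul_le_mul_right (he ▸ h x) hx

theorem LinearMap.pow_le_norm_det {T : E →ₗ[ℂ] E} {m : ℝ} (hm : 0 ≤ m)
    (h : ∀ x, m * ‖x‖ ≤ ‖T x‖) : m ^ Module.finrank ℂ E ≤ ‖LinearMap.det T‖ := by
  rw [T.det_eq_prod_roots_charpoly, ← T.card_roots_charpoly]
  refine Multiset.pow_card_le_norm_prod hm fun μ hμ => ?_
  obtain ⟨x, hx, he⟩ := LinearMap.exists_norm_eq_of_mem_roots_charpoly hμ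
  exact le_of_mul_le_mul_right (he ▸ h x) hx

/-- Composing `J` with a transvection makes it block diagonal for the decompositions
`ℂ z ⊕ zᗮ` and `ℂ (J v) ⊕ (J v)ᗮ`. -/
theorem exists_blockDiagonal {J : E →ₗ[ℂ] E} {z v : E} {c m : ℝ} (hz : z ≠ 0) (hw : J v ≠ 0)
    (hc : 0 < c) (hm : 0 < m) (hv : inner ℂ z v = c * (‖z‖ : ℂ) ^ 2)
    (hJ : ∀ δ, inner ℂ z δ = 0 → inner ℂ (J v) (J δ) = 0) :
    ∃ T : E →ₗ[ℂ] E, ‖LinearMap.det T‖ = ‖LinearMap.det J‖ * (m * ‖z‖ / ‖J v‖ * c) ∧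
      ∀ x, ∃ δ, inner ℂ z δ = 0 ∧ ∃ s : ℝ, ‖x‖ ^ 2 = s + ‖δ‖ ^ 2 ∧
        ‖T x‖ ^ 2 = m ^ 2 * s + ‖J δ‖ ^ 2 := by
  have hr : 0 < ‖z‖ := norm_pos_iff.2 hz
  have hR : 0 < ‖J v‖ := norm_pos_iff.2 hw
  have hr' : (‖z‖ : ℂ) ^ 2 ≠ 0 := by simpa using hz
  have hzz : inner ℂ z z = (‖z‖ : ℂ) ^ 2 := inner_self_eq_norm_sq_to_K z
  -- Chosen so that `‖κ • J v‖ = m * ‖z‖`: the radial direction is then scaled by exactly `m`.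
  set κ : ℝ := m * ‖z‖ / ‖J v‖ with hκ
  have hκ0 : 0 < κ := by positivity
  -- The transvection `x ↦ x + ⟨x, z⟩ q` fixes the complement of `z` and sends `z` to `κ • v`; its
  -- determinant is `κ * c`.
  set q : E := ((‖z‖ : ℂ) ^ 2)⁻¹ • ((κ : ℂ) • v - z) with hq
  set φ : Module.Dual ℂ E := (innerSL ℂ z : E →L[ℂ] ℂ).toLinearMap with hφ
  have hφa : ∀ x, φ x = inner ℂ z x := fun x => rfl
  refine ⟨J ∘ₗ LinearMap.transvection φ q, ?_, fun x => ?_⟩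
  · have : 1 + φ q = ((κ * c : ℝ) : ℂ) := by
      rw [hφa, hq, inner_smul_right, inner_sub_right, inner_smul_right, hv, hzz]
      push_cast
      linear_combination ((κ : ℂ) * c - 1) * inv_mul_cancel₀ hr'
    rw [LinearMap.det_comp, LinearMap.transvection.det, this, norm_mul, Complex.norm_real,
      Real.norm_eq_abs, abs_of_pos (by positivity)]
  · set a : ℂ := inner ℂ z x / (‖z‖ : ℂ) ^ 2 with ha
    have hxa : inner ℂ z x = a * (‖z‖ : ℂ) ^ 2 := by rw [ha, div_mul_cancel₀ _ hr']
    set δ : E := x - a • z with hδ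
    have hzδ : inner ℂ z δ = 0 := by
      rw [hδ, inner_sub_right, inner_smul_right, hzz, hxa, sub_self]
    have hx : x = a • z + δ := by rw [hδ]; abel
    have hT : (J ∘ₗ LinearMap.transvection φ q) x = (a * κ) • J v + J δ := by
      rw [LinearMap.comp_apply, LinearMap.transvection.apply, hφa, hxa, hq, smul_smul,
        mul_assoc, mul_inv_cancel₀ hr', mul_one, smul_sub, smul_smul, ← map_smul, ← map_add, hδ]
      congr 1
      abel
    refine ⟨δ, hzδ, (‖a‖ * ‖z‖) ^ 2, ?_, ?_⟩
    · conv_lhs => rw [hx]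
      rw [norm_add_sq_of_inner_eq_zero (by rw [inner_smul_left, hzδ, mul_zero, Complex.zero_re]),
        norm_smul]
    · rw [hT, norm_add_sq_of_inner_eq_zero
        (by rw [inner_smul_left, hJ δ hzδ, mul_zero, Complex.zero_re]), norm_smul, norm_mul,
        Complex.norm_real, Real.norm_eq_abs, abs_of_pos hκ0, hκ]
      field_simp

theorem norm_det_mul_le {J : E →ₗ[ℂ] E} {z v : E} {c m : ℝ} (hz : z ≠ 0) (hw : J v ≠ 0)
    (hc : 0 < c) (hm : 0 < m) (hv : inner ℂ z v = c * (‖z‖ : ℂ) ^ 2)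
    (hJ : ∀ δ, inner ℂ z δ = 0 → inner ℂ (J v) (J δ) = 0)
    (hb : ∀ δ, inner ℂ z δ = 0 → ‖J δ‖ ≤ m * ‖δ‖) :
    ‖LinearMap.det J‖ * (m * ‖z‖ / ‖J v‖ * c) ≤ m ^ Module.finrank ℂ E := by
  obtain ⟨T, hdet, hT⟩ := exists_blockDiagonal hz hw hc hm hv hJ
  rw [← hdet]
  refine LinearMap.norm_det_le_pow fun x => ?_
  obtain ⟨δ, hδ, s, hx, hTx⟩ := hT x
  rw [← sq_le_sq₀ (norm_nonneg _) (by positivity), mul_pow, hx, hTx, mul_add, ← mul_pow]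
  gcongr
  exact hb δ hδ

theorem le_norm_det_mul {J : E →ₗ[ℂ] E} {z v : E} {c m : ℝ} (hz : z ≠ 0) (hw : J v ≠ 0)
    (hc : 0 < c) (hm : 0 < m) (hv : inner ℂ z v = c * (‖z‖ : ℂ) ^ 2)
    (hJ : ∀ δ, inner ℂ z δ = 0 → inner ℂ (J v) (J δ) = 0)
    (hb : ∀ δ, inner ℂ z δ = 0 → m * ‖δ‖ ≤ ‖J δ‖) :
    m ^ Module.finrank ℂ E ≤ ‖LinearMap.det J‖ * (m * ‖z‖ / ‖J v‖ * c) := by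
  obtain ⟨T, hdet, hT⟩ := exists_blockDiagonal hz hw hc hm hv hJ
  rw [← hdet]
  refine LinearMap.pow_le_norm_det hm.le fun x => ?_
  obtain ⟨δ, hδ, s, hx, hTx⟩ := hT x
  rw [← sq_le_sq₀ (by positivity) (norm_nonneg _), mul_pow, hx, hTx, mul_add, ← mul_pow]
  gcongr
  exact hb δ hδ

end Det

/-! ### Radial derivative at extremal points and the growth theorem -/

namespace StarlikeDistortion

variable {n : ℕ} {γ : ℝ} {f : Cn n → Cn n} {z : Cn n}

theorem IsNormalizedHolomorphic.hasFDerivAt (hf : IsNormalizedHolomorphic f)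
    (hz : z ∈ unitBall n) : HasFDerivAt f (jacobian f z) z :=
  (hf.holomorphic.differentiableAt (isOpen_ball.mem_nhds hz)).hasFDerivAt

theorem IsStarlikeOfOrder.ne_zero (hf : IsStarlikeOfOrder γ f) (hz : z ∈ unitBall n)
    (hz0 : z ≠ 0) : f z ≠ 0 := by
  obtain ⟨k, -, hk⟩ := hf.biholomorphic.exists_inverse
  intro h
  have h0 := hk 0 (mem_ball_self one_pos)
  have h1 := hk z hz
  rw [hf.gStarlike.normalized.map_zero] at h0
  rw [h, h0] at h1
  exact hz0 h1.symm

theorem IsStarlikeOfOrder.exists_radial (hγ0 : 0 < γ) (hγ1 : γ < 1) (hf : IsStarlikeOfOrder γ f)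
    (hz : z ∈ unitBall n) (hz0 : z ≠ 0)
    (hext : IsExtrOn (fun ξ => ‖f ξ‖) (sphere 0 ‖z‖) z) :
    ∃ c : ℝ, (1 - ‖z‖) / (1 + (1 - 2 * γ) * ‖z‖) ≤ c ∧
      c ≤ (1 + ‖z‖) / (1 - (1 - 2 * γ) * ‖z‖) ∧
      c * (inner ℂ (f z) (jacobian f z z)).re = ‖f z‖ ^ 2 ∧
      inner ℂ z ((jacobian f z).inverse (f z)) = c * (‖z‖ : ℂ) ^ 2 := by
  have hz' : (‖z‖ : ℂ) ^ 2 ≠ 0 := by simpa using hz0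
  have hd := hf.gStarlike.normalized.hasFDerivAt hz
  have h1 := inner_mul_inner_of_isExtrOn hz0 hd hext
    ((hf.gStarlike.nonsingular z hz).self_apply_inverse (f z))
  obtain ⟨η, hη, he⟩ := hf.gStarlike.memM.exists_norm_le hγ0 hγ1 hz hz0
  set L := inner ℂ (f z) (jacobian f z z) with hL
  have hLre : L = (L.re : ℂ) := by
    apply Complex.ext
    · simp
    · simpa using im_inner_fderiv_self_eq_zero_of_isExtrOn hz0 hd hext
  have hR : (‖f z‖ : ℂ) ^ 2 ≠ 0 := by simpa using hf.ne_zero hz hz0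
  have hL0 : L ≠ 0 := by
    intro h
    rw [h, mul_zero] at h1
    exact hR h1.symm
  have hL0' : L.re ≠ 0 := by
    intro h
    rw [hLre, h] at hL0
    exact hL0 rfl
  have hc : inner ℂ z ((jacobian f z).inverse (f z)) / (‖z‖ : ℂ) ^ 2 =
      ((‖f z‖ ^ 2 / L.re : ℝ) : ℂ) := by
    push_cast
    rw [← hLre, eq_div_iff hL0, h1]
  obtain ⟨b1, b2⟩ := orderFun_real_bounds hγ0 hγ1 (mem_ball_zero_iff.1 hz) hη (hc ▸ he)
  exact ⟨_, b1, b2, div_mul_cancel₀ _ hL0', by rw [← hc, div_mul_cancel₀ _ hz']⟩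

/-- The ratio tends to 1 because `J_f(0) = I`, and the default value `log (0 / 0) = 0` agrees with
`log 1`. -/
theorem IsNormalizedHolomorphic.continuousAt_log_norm_div (hf : IsNormalizedHolomorphic f) :
    ContinuousAt (fun ξ => Real.log (‖f ξ‖ / ‖ξ‖)) 0 := by
  have h1 : Tendsto (fun ξ => ‖f ξ‖ / ‖ξ‖) (𝓝[≠] 0) (𝓝 1) := by
    rw [Metric.tendsto_nhds]
    intro c hc
    have hd := hf.hasFDerivAt (mem_ball_self one_pos)
    rw [hf.jacobian_zero] at hd
    have h2 := hd.isLittleO.bound (half_pos hc)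
    filter_upwards [nhdsWithin_le_nhds h2, self_mem_nhdsWithin] with ξ hξ hξ0
    have hn : 0 < ‖ξ‖ := norm_pos_iff.2 hξ0
    simp only [hf.map_zero, sub_zero, ContinuousLinearMap.id_apply] at hξ
    have h3 := (abs_norm_sub_norm_le _ _).trans hξ
    rw [Real.dist_eq, div_sub_one hn.ne', abs_div, abs_of_pos hn, div_lt_iff₀ hn]
    nlinarith
  rw [continuousAt_iff_punctured_nhds]
  simpa using h1.log one_ne_zero

theorem nonneg_of_hasDerivAt_of_le_left {q : ℝ → ℝ} {D a b : ℝ} (hab : a < b)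
    (hq : ∀ s ∈ Ioo a b, q s ≤ q b) (hd : HasDerivAt q D b) : 0 ≤ D := by
  have h1 := (hasDerivAt_iff_tendsto_slope.1 hd).mono_left
    (nhdsWithin_mono b (show Iio b ⊆ {b}ᶜ from fun s hs => ne_of_lt hs))
  refine ge_of_tendsto h1 ?_
  filter_upwards [Ioo_mem_nhdsLT hab] with s hs
  rw [slope_def_field]
  exact div_nonneg_of_nonpos (by linarith [hq s hs]) (by linarith [hs.2])

/-- A comparison principle for the growth of `‖f‖`: it suffices to control the logarithmic radial
derivative at the points which are extremal on their spheres. -/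
theorem IsNormalizedHolomorphic.growth_comparison (hf : IsNormalizedHolomorphic f)
    (hne : ∀ ξ ∈ unitBall n, ξ ≠ 0 → f ξ ≠ 0) (σ : ℝ) {u u' : ℝ → ℝ} (hu0 : u 0 = 0)
    (hu : ∀ t ∈ Ico (0 : ℝ) 1, HasDerivAt u (u' t) t)
    (hext : ∀ ξ ∈ unitBall n, ξ ≠ 0 →
      IsMaxOn (fun ζ => σ * Real.log ‖f ζ‖) (sphere 0 ‖ξ‖) ξ →
      σ * ((inner ℂ (f ξ) (jacobian f ξ ξ)).re / ‖f ξ‖ ^ 2 - 1) + ‖ξ‖ * u' ‖ξ‖ < 0)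
    (hz : z ∈ unitBall n) : σ * Real.log (‖f z‖ / ‖z‖) + u ‖z‖ ≤ 0 := by
  set Φ : Cn n → ℝ := fun ξ => σ * Real.log (‖f ξ‖ / ‖ξ‖) + u ‖ξ‖ with hΦ
  have hsub : closedBall (0 : Cn n) ‖z‖ ⊆ unitBall n :=
    closedBall_subset_ball (mem_ball_zero_iff.1 hz)
  have hcont : ContinuousOn Φ (closedBall 0 ‖z‖) := by
    intro ξ hξ
    apply ContinuousAt.continuousWithinAt
    have hξ1 : ‖ξ‖ < 1 := mem_ball_zero_iff.1 (hsub hξ)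
    have hlog : ContinuousAt (fun ξ => Real.log (‖f ξ‖ / ‖ξ‖)) ξ := by
      rcases eq_or_ne ξ 0 with rfl | hξ0
      · exact hf.continuousAt_log_norm_div
      · have hn := norm_ne_zero_iff.2 hξ0
        have hfn := norm_ne_zero_iff.2 (hne ξ (hsub hξ) hξ0)
        exact ((hf.hasFDerivAt (hsub hξ)).continuousAt.norm.div continuousAt_id.norm hn).log
          (div_ne_zero hfn hn)
    exact (continuousAt_const.mul hlog).add
      (ContinuousAt.comp (f := fun ξ : Cn n => ‖ξ‖) (hu _ ⟨norm_nonneg _, hξ1⟩).continuousAt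
        continuous_norm.continuousAt)
  obtain ⟨ξ, hξ, hmax⟩ := (isCompact_closedBall (0 : Cn n) ‖z‖).exists_isMaxOn
    ⟨z, by simp⟩ hcont
  refine (hmax (show z ∈ closedBall (0 : Cn n) ‖z‖ by simp)).trans ?_
  rcases eq_or_ne ξ 0 with rfl | hξ0
  · simp [hΦ, hu0]
  exfalso
  have hξb := hsub hξ
  have hξ1 : ‖ξ‖ < 1 := mem_ball_zero_iff.1 hξb
  have hr : 0 < ‖ξ‖ := norm_pos_iff.2 hξ0
  have hΦe : ∀ ζ ∈ unitBall n, ζ ≠ 0 →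
      Φ ζ = σ * (Real.log ‖f ζ‖ - Real.log ‖ζ‖) + u ‖ζ‖ := fun ζ hζ hζ0 => by
    simp only [hΦ]
    rw [Real.log_div (norm_ne_zero_iff.2 (hne ζ hζ hζ0)) (norm_ne_zero_iff.2 hζ0)]
  -- On a sphere `Φ` differs from `σ * log ‖f‖` by a constant, so a maximum of `Φ` over the ball is
  -- extremal for `‖f‖` on its sphere.
  have hsph : IsMaxOn (fun ζ => σ * Real.log ‖f ζ‖) (sphere 0 ‖ξ‖) ξ := by
    intro ζ hζ
    rw [mem_sphere_zero_iff_norm] at hζ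
    have hζc : ζ ∈ closedBall (0 : Cn n) ‖z‖ := by
      rw [mem_closedBall_zero_iff, hζ]; exact mem_closedBall_zero_iff.1 hξ
    have hζ0 : ζ ≠ 0 := by rw [← norm_pos_iff, hζ]; exact hr
    have h1 : Φ ζ ≤ Φ ξ := hmax hζc
    rw [hΦe ζ (hsub hζc) hζ0, hΦe ξ hξb hξ0, hζ] at h1
    change σ * Real.log ‖f ζ‖ ≤ σ * Real.log ‖f ξ‖
    linarith
  have hneg := hext ξ hξb hξ0 hsph
  have hR : ‖f ξ‖ ^ 2 ≠ 0 := pow_ne_zero 2 (norm_ne_zero_iff.2 (hne ξ hξb hξ0))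
  -- `Φ` along the ray through `ξ`. Since `ξ` may lie on the boundary of the closed ball, only the
  -- left derivative condition at `s = 1` is available; `hneg` contradicts it.
  set q : ℝ → ℝ := fun s => σ * (Real.log (‖f (s • ξ)‖ ^ 2) / 2 - Real.log (s * ‖ξ‖)) +
    u (s * ‖ξ‖) with hq
  have hqΦ : ∀ s ∈ Ioc (0 : ℝ) 1, s • ξ ∈ closedBall (0 : Cn n) ‖z‖ ∧ q s = Φ (s • ξ) := by
    intro s hs
    have hn : ‖s • ξ‖ = s * ‖ξ‖ := by rw [norm_smul, Real.norm_eq_abs, abs_of_pos hs.1]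
    have hmem : s • ξ ∈ closedBall (0 : Cn n) ‖z‖ := by
      rw [mem_closedBall_zero_iff, hn]
      have := mem_closedBall_zero_iff.1 hξ
      nlinarith [hs.2]
    refine ⟨hmem, ?_⟩
    rw [hΦe _ (hsub hmem) (smul_ne_zero hs.1.ne' hξ0), hn]
    simp only [hq, Real.log_pow]
    push_cast
    ring
  have hg : HasDerivAt (fun s : ℝ => s • ξ) ξ 1 := by
    simpa using (hasDerivAt_id (1 : ℝ)).smul_const ξ
  have hm : HasDerivAt (fun s : ℝ => s * ‖ξ‖) ‖ξ‖ 1 := by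
    simpa using (hasDerivAt_id (1 : ℝ)).mul_const ‖ξ‖
  have hd1 := hasDerivAt_norm_sq_of_complex (HasFDerivAt.comp_hasDerivAt_real (f := f)
    (J := jacobian f ξ) (by simpa using hf.hasFDerivAt hξb) hg)
  have hd2 := (hd1.log (by simpa using hR)).div_const 2
  have hd3 := hm.log (by simpa using hr.ne')
  have hd4 : HasDerivAt (fun s : ℝ => u (s * ‖ξ‖)) (u' (1 * ‖ξ‖) * ‖ξ‖) 1 :=
    HasDerivAt.comp (1 : ℝ) (hu _ (by rw [one_mul]; exact ⟨hr.le, hξ1⟩)) hm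
  have hd : HasDerivAt q _ 1 := ((hd2.sub hd3).const_mul σ).add hd4
  have := nonneg_of_hasDerivAt_of_le_left one_pos (fun s hs => by
    obtain ⟨h1, h2⟩ := hqΦ s ⟨hs.1, hs.2.le⟩
    rw [h2, (hqΦ 1 ⟨one_pos, le_rfl⟩).2, one_smul]
    exact hmax h1) hd
  rw [one_smul, one_mul, div_self hr.ne'] at this
  have e : 2 * (inner ℂ (f ξ) (jacobian f ξ ξ)).re / ‖f ξ‖ ^ 2 / 2 =
      (inner ℂ (f ξ) (jacobian f ξ ξ)).re / ‖f ξ‖ ^ 2 := by ring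
  rw [e] at this
  linarith

theorem le_zero_of_forall_sub_mul_le {a b : ℝ} (h : ∀ ε > 0, a - ε * b ≤ 0) : a ≤ 0 := by
  have ht : Tendsto (fun ε : ℝ => a - ε * b) (𝓝[>] 0) (𝓝 a) := by
    have : ContinuousAt (fun ε : ℝ => a - ε * b) 0 := by fun_prop
    have := this.tendsto.mono_left (nhdsWithin_le_nhds (s := Ioi 0))
    simpa using this
  exact le_of_tendsto ht (by filter_upwards [self_mem_nhdsWithin] with ε hε using h ε hε)

/-- At a maximum the logarithmic radial derivative is `1 / c ≤ 1 / g(ρ)`, and `1 / g(ρ) - 1 = 2(1 -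
γ)ρ / (1 - ρ)` is the contribution of `(1 - ρ) ^ (2(γ - 1))`. The term `ε * t` makes the comparison
strict. -/
theorem IsStarlikeOfOrder.norm_div_le (hγ0 : 0 < γ) (hγ1 : γ < 1) (hf : IsStarlikeOfOrder γ f)
    (hz : z ∈ unitBall n) (hz0 : z ≠ 0) :
    ‖f z‖ / ‖z‖ ≤ (1 - ‖z‖) ^ (2 * (γ - 1)) := by
  have hr : 0 < ‖z‖ := norm_pos_iff.2 hz0
  have hr1 : ‖z‖ < 1 := mem_ball_zero_iff.1 hz
  have hR : 0 < ‖f z‖ := norm_pos_iff.2 (hf.ne_zero hz hz0)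
  have key : Real.log (‖f z‖ / ‖z‖) - 2 * (γ - 1) * Real.log (1 - ‖z‖) ≤ 0 := by
    refine le_zero_of_forall_sub_mul_le (b := ‖z‖) fun ε hε => ?_
    have := hf.gStarlike.normalized.growth_comparison (fun ξ => hf.ne_zero) 1
      (u := fun t => -(2 * (γ - 1) * Real.log (1 - t)) - ε * t)
      (u' := fun t => -(2 * (γ - 1) * (-1 / (1 - t))) - ε * 1) (by simp)
      (fun t ht => ((((hasDerivAt_id t).const_sub 1).log
        (by simp only [id]; linarith [ht.2])).const_mul _).neg.sub ((hasDerivAt_id t).const_mul ε))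
      (fun ξ hξ hξ0 hmax => ?_) hz
    · linarith
    · have hρ : 0 < ‖ξ‖ := norm_pos_iff.2 hξ0
      have hρ1 : ‖ξ‖ < 1 := mem_ball_zero_iff.1 hξ
      have hmax' : IsMaxOn (fun ζ => ‖f ζ‖) (sphere 0 ‖ξ‖) ξ := fun ζ hζ => by
        have hζ' := mem_sphere_zero_iff_norm.1 hζ
        have h1 : 1 * Real.log ‖f ζ‖ ≤ 1 * Real.log ‖f ξ‖ := hmax hζ
        rw [one_mul, one_mul] at h1
        refine (Real.log_le_log_iff (norm_pos_iff.2 (hf.ne_zero ?_ ?_))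
          (norm_pos_iff.2 (hf.ne_zero hξ hξ0))).1 h1
        · rw [unitBall, mem_ball_zero_iff, hζ']; exact hρ1
        · rw [← norm_pos_iff, hζ']; exact hρ
      obtain ⟨c, hc1, -, hc3, -⟩ := hf.exists_radial hγ0 hγ1 hξ hξ0 (Or.inr hmax')
      have hRξ : 0 < ‖f ξ‖ := norm_pos_iff.2 (hf.ne_zero hξ hξ0)
      have p1 : 0 < 1 - ‖ξ‖ := by linarith
      have p2 : 0 < 1 + (1 - 2 * γ) * ‖ξ‖ := by nlinarith
      have hc0 : 0 < c := (div_pos p1 p2).trans_le hc1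
      have hL : (inner ℂ (f ξ) (jacobian f ξ ξ)).re / ‖f ξ‖ ^ 2 = c⁻¹ := by
        rw [div_eq_iff (by positivity), ← hc3, inv_mul_cancel_left₀ hc0.ne']
      have hci : c⁻¹ ≤ (1 + (1 - 2 * γ) * ‖ξ‖) / (1 - ‖ξ‖) := by
        rw [← inv_div]
        exact inv_anti₀ (div_pos p1 p2) hc1
      have e : (1 + (1 - 2 * γ) * ‖ξ‖) / (1 - ‖ξ‖) - 1 +
          ‖ξ‖ * -(2 * (γ - 1) * (-1 / (1 - ‖ξ‖))) = 0 := by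
        field_simp
        ring
      rw [hL]
      nlinarith [mul_pos hε hρ]
  rw [Real.rpow_def_of_pos (by linarith), ← Real.log_le_iff_le_exp (div_pos hR hr)]
  linarith

/-- The same comparison with `σ = -1`, at minima, using `1 - 1 / g(-ρ) = 2(1 - γ)ρ / (1 + ρ)`. -/
theorem IsStarlikeOfOrder.le_norm_div (hγ0 : 0 < γ) (hγ1 : γ < 1) (hf : IsStarlikeOfOrder γ f)
    (hz : z ∈ unitBall n) (hz0 : z ≠ 0) :
    (1 + ‖z‖) ^ (-2 * (1 - γ)) ≤ ‖f z‖ / ‖z‖ := by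
  have hr : 0 < ‖z‖ := norm_pos_iff.2 hz0
  have hR : 0 < ‖f z‖ := norm_pos_iff.2 (hf.ne_zero hz hz0)
  have key : -Real.log (‖f z‖ / ‖z‖) + -2 * (1 - γ) * Real.log (1 + ‖z‖) ≤ 0 := by
    refine le_zero_of_forall_sub_mul_le (b := ‖z‖) fun ε hε => ?_
    have := hf.gStarlike.normalized.growth_comparison (fun ξ => hf.ne_zero) (-1)
      (u := fun t => (-2 * (1 - γ) * Real.log (1 + t)) - ε * t)
      (u' := fun t => (-2 * (1 - γ) * (1 / (1 + t))) - ε * 1) (by simp)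
      (fun t ht => ((((hasDerivAt_id t).const_add 1).log
        (by simp only [id]; linarith [ht.1])).const_mul _).sub ((hasDerivAt_id t).const_mul ε))
      (fun ξ hξ hξ0 hmax => ?_) hz
    · linarith
    · have hρ : 0 < ‖ξ‖ := norm_pos_iff.2 hξ0
      have hρ1 : ‖ξ‖ < 1 := mem_ball_zero_iff.1 hξ
      have hmin : IsMinOn (fun ζ => ‖f ζ‖) (sphere 0 ‖ξ‖) ξ := fun ζ hζ => by
        have hζ' := mem_sphere_zero_iff_norm.1 hζ
        have h1 : -1 * Real.log ‖f ζ‖ ≤ -1 * Real.log ‖f ξ‖ := hmax hζ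
        refine (Real.log_le_log_iff (norm_pos_iff.2 (hf.ne_zero hξ hξ0))
          (norm_pos_iff.2 (hf.ne_zero ?_ ?_))).1 (by linarith)
        · rw [unitBall, mem_ball_zero_iff, hζ']; exact hρ1
        · rw [← norm_pos_iff, hζ']; exact hρ
      obtain ⟨c, hc1, hc2, hc3, -⟩ := hf.exists_radial hγ0 hγ1 hξ hξ0 (Or.inl hmin)
      have hRξ : 0 < ‖f ξ‖ := norm_pos_iff.2 (hf.ne_zero hξ hξ0)
      have p1 : 0 < 1 - ‖ξ‖ := by linarith
      have p2 : 0 < 1 + (1 - 2 * γ) * ‖ξ‖ := by nlinarith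
      have p3 : 0 < 1 - (1 - 2 * γ) * ‖ξ‖ := by nlinarith
      have hc0 : 0 < c := (div_pos p1 p2).trans_le hc1
      have hL : (inner ℂ (f ξ) (jacobian f ξ ξ)).re / ‖f ξ‖ ^ 2 = c⁻¹ := by
        rw [div_eq_iff (by positivity), ← hc3, inv_mul_cancel_left₀ hc0.ne']
      have hci : (1 - (1 - 2 * γ) * ‖ξ‖) / (1 + ‖ξ‖) ≤ c⁻¹ := by
        rw [← inv_div]
        exact inv_anti₀ hc0 hc2
      have e : -1 * ((1 - (1 - 2 * γ) * ‖ξ‖) / (1 + ‖ξ‖) - 1) +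
          ‖ξ‖ * (-2 * (1 - γ) * (1 / (1 + ‖ξ‖))) = 0 := by
        field_simp
        ring
      rw [hL]
      nlinarith [mul_pos hε hρ]
  rw [Real.rpow_def_of_pos (by linarith), ← Real.le_log_iff_exp_le (div_pos hR hr)]
  linarith

end StarlikeDistortion

/-! ### Distortion theorems -/

namespace StarlikeDistortion

variable {n : ℕ} {γ : ℝ} {f : Cn n → Cn n} {z : Cn n}

theorem mul_rpow_neg_half_sq {A c x : ℝ} (hc : 0 < c) :
    (A * c ^ (-(1 / 2 : ℝ)) * x) ^ 2 = A ^ 2 / c * x ^ 2 := by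
  have : (c ^ (-(1 / 2 : ℝ))) ^ 2 = c⁻¹ := by
    rw [← Real.rpow_natCast, ← Real.rpow_mul hc.le, ← Real.rpow_neg_one]
    norm_num
  rw [mul_pow, mul_pow, this, div_eq_mul_inv]

theorem pow_mul_rpow_neg_half {A c : ℝ} (hA : 0 < A) (hc : 0 < c) (n : ℕ) :
    (A * c ^ (-(1 / 2 : ℝ))) ^ n / (A * c ^ (-(1 / 2 : ℝ)) * A⁻¹ * c) =
      A ^ n * c ^ (-(((n : ℝ) + 1) / 2)) := by
  have h1 : (c ^ (-(1 / 2 : ℝ))) ^ n = c ^ (-(n / 2 : ℝ)) := by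
    rw [← Real.rpow_natCast, ← Real.rpow_mul hc.le]
    congr 1
    ring
  have h2 : c ^ (-(1 / 2 : ℝ)) * c = c ^ (1 / 2 : ℝ) := by
    rw [← Real.rpow_add_one hc.ne']
    norm_num
  have h3 : A * c ^ (-(1 / 2 : ℝ)) * A⁻¹ * c = c ^ (1 / 2 : ℝ) := by
    rw [← h2]; field_simp
  have h4 : -(((n : ℝ) + 1) / 2) = -(n / 2 : ℝ) - 1 / 2 := by ring
  rw [h3, mul_pow, h1, h4, Real.rpow_sub hc, mul_div_assoc]

/-- Rescales a bound for tangent vectors of length `‖z‖` to all tangent vectors. -/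
theorem exists_tangent_rescale {δ : Cn n} (hz0 : z ≠ 0) (hδ : inner ℂ z δ = 0) (hδ0 : δ ≠ 0) :
    ∃ k : ℝ, 0 < k ∧ inner ℂ z ((k : ℂ) • δ) = 0 ∧ ‖(k : ℂ) • δ‖ = ‖z‖ ∧ k * ‖δ‖ = ‖z‖ := by
  have h1 : 0 < ‖δ‖ := norm_pos_iff.2 hδ0
  have h2 : 0 < ‖z‖ := norm_pos_iff.2 hz0
  have h3 : ‖z‖ / ‖δ‖ * ‖δ‖ = ‖z‖ := div_mul_cancel₀ _ h1.ne'
  refine ⟨‖z‖ / ‖δ‖, by positivity, by rw [inner_smul_right, hδ, mul_zero], ?_, h3⟩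
  rw [norm_smul, Complex.norm_real, Real.norm_eq_abs, abs_of_pos (by positivity), h3]

theorem finrank_Cn (n : ℕ) : Module.finrank ℂ (Cn n) = n := by simp

theorem IsStarlikeOfOrder.distortion_of_isMaxOn (hγ0 : 0 < γ) (hγ1 : γ < 1)
    (hf : IsStarlikeOfOrder γ f) (hz : z ∈ unitBall n) (hz0 : z ≠ 0)
    (hmax : IsMaxOn (fun ξ => ‖f ξ‖) (sphere 0 ‖z‖) z) :
    ‖(jacobian f z).det‖ ≤ (1 - ‖z‖) ^ (2 * (γ - 1) * (n : ℝ)) *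
        ((1 - ‖z‖) / (1 + (1 - 2 * γ) * ‖z‖)) ^ (-(((n : ℝ) + 1) / 2)) ∧
      ∀ δ ∈ holTangentSpace z, ‖jacobian f z δ‖ ≤ (1 - ‖z‖) ^ (2 * (γ - 1)) *
        ((1 - ‖z‖) / (1 + (1 - 2 * γ) * ‖z‖)) ^ (-(1 / 2 : ℝ)) * ‖δ‖ := by
  have hr : 0 < ‖z‖ := norm_pos_iff.2 hz0
  have hr1 : ‖z‖ < 1 := mem_ball_zero_iff.1 hz
  have hR : 0 < ‖f z‖ := norm_pos_iff.2 (hf.ne_zero hz hz0)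
  have hd := hf.gStarlike.normalized.hasFDerivAt hz
  obtain ⟨c, hc1, -, hc3, hc4⟩ := hf.exists_radial hγ0 hγ1 hz hz0 (Or.inr hmax)
  have hg : 0 < (1 - ‖z‖) / (1 + (1 - 2 * γ) * ‖z‖) := div_pos (by linarith) (by nlinarith)
  set g := (1 - ‖z‖) / (1 + (1 - 2 * γ) * ‖z‖)
  have hc : 0 < c := hg.trans_le hc1
  set A := ‖f z‖ / ‖z‖ with hA
  have hA0 : 0 < A := div_pos hR hr
  have hAle : A ≤ (1 - ‖z‖) ^ (2 * (γ - 1)) := hf.norm_div_le hγ0 hγ1 hz hz0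
  have hp0 : 0 < (1 - ‖z‖) := by linarith
  -- By homogeneity from `‖J δ‖² ≤ L = ‖f z‖² / c` for `‖δ‖ = ‖z‖`.
  have htan : ∀ δ, inner ℂ z δ = 0 → ‖jacobian f z δ‖ ≤ A * c ^ (-(1 / 2 : ℝ)) * ‖δ‖ := by
    intro δ hδ
    rcases eq_or_ne δ 0 with rfl | hδ0
    · simp
    obtain ⟨k, hk, h1, h2, h3⟩ := exists_tangent_rescale hz0 hδ hδ0
    have h4 := norm_fderiv_sq_le_of_isMaxOn hz0 hf.gStarlike.normalized.holomorphic hr1 hd hmax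
      h1 h2
    rw [map_smul, norm_smul, Complex.norm_real, Real.norm_eq_abs, abs_of_pos hk] at h4
    rw [← sq_le_sq₀ (norm_nonneg _) (by positivity), mul_rpow_neg_half_sq hc, hA, ← h3]
    have h5 : (‖f z‖ / (k * ‖δ‖)) ^ 2 / c * ‖δ‖ ^ 2 =
        (inner ℂ (f z) (jacobian f z z)).re / k ^ 2 := by
      have := norm_pos_iff.2 hδ0
      rw [div_pow, ← hc3]
      field_simp
    rw [h5, le_div_iff₀ (by positivity)]
    nlinarith
  have hv := (hf.gStarlike.nonsingular z hz).self_apply_inverse (f z)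
  constructor
  · have := norm_det_mul_le (J := (jacobian f z).toLinearMap) (c := c)
      (m := A * c ^ (-(1 / 2 : ℝ))) hz0 (v := (jacobian f z).inverse (f z))
      (by change jacobian f z _ ≠ 0; rw [hv]; exact hf.ne_zero hz hz0) hc (by positivity) hc4
      (fun δ hδ => by
        change inner ℂ (jacobian f z _) (jacobian f z δ) = 0
        rw [hv]
        exact inner_fderiv_eq_zero_of_isExtrOn hz0 hd (Or.inr hmax) hδ)
      htan
    rw [ContinuousLinearMap.coe_coe, hv, finrank_Cn, mul_div_assoc, ← inv_div ‖f z‖ ‖z‖, ← hA,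
      ← le_div_iff₀ (by positivity), pow_mul_rpow_neg_half hA0 hc] at this
    refine this.trans ?_
    rw [Real.rpow_mul hp0.le, Real.rpow_natCast]
    gcongr ?_ ^ n * ?_
    -- The exponent of `c` is negative, so the lower bound `g ≤ c` is the one needed.
    exact Real.rpow_le_rpow_of_nonpos hg hc1 (by linarith [(Nat.cast_nonneg n : (0 : ℝ) ≤ n)])
  · intro δ hδ
    refine (htan δ hδ).trans ?_
    gcongr ?_ * ?_ * _
    exact Real.rpow_le_rpow_of_nonpos hg hc1 (by norm_num)

theorem IsStarlikeOfOrder.distortion_of_isMinOn (hγ0 : 0 < γ) (hγ1 : γ < 1)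
    (hf : IsStarlikeOfOrder γ f) (hz : z ∈ unitBall n) (hz0 : z ≠ 0)
    (hmin : IsMinOn (fun ξ => ‖f ξ‖) (sphere 0 ‖z‖) z) :
    (1 + ‖z‖) ^ (-2 * (1 - γ) * (n : ℝ)) *
        ((1 + ‖z‖) / (1 - (1 - 2 * γ) * ‖z‖)) ^ (-(((n : ℝ) + 1) / 2)) ≤
        ‖(jacobian f z).det‖ ∧
      ∀ δ ∈ holTangentSpace z, (1 + ‖z‖) ^ (-2 * (1 - γ)) *
        ((1 + ‖z‖) / (1 - (1 - 2 * γ) * ‖z‖)) ^ (-(1 / 2 : ℝ)) * ‖δ‖ ≤ ‖jacobian f z δ‖ := by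
  have hr : 0 < ‖z‖ := norm_pos_iff.2 hz0
  have hr1 : ‖z‖ < 1 := mem_ball_zero_iff.1 hz
  have hR : 0 < ‖f z‖ := norm_pos_iff.2 (hf.ne_zero hz hz0)
  have hd := hf.gStarlike.normalized.hasFDerivAt hz
  obtain ⟨c, hc1, hc2, hc3, hc4⟩ := hf.exists_radial hγ0 hγ1 hz hz0 (Or.inl hmin)
  have hc : 0 < c :=
    (div_pos (a := 1 - ‖z‖) (b := 1 + (1 - 2 * γ) * ‖z‖) (by linarith) (by nlinarith)).trans_le hc1
  set g := (1 + ‖z‖) / (1 - (1 - 2 * γ) * ‖z‖)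
  have hg : 0 < g := hc.trans_le hc2
  set A := ‖f z‖ / ‖z‖ with hA
  have hA0 : 0 < A := div_pos hR hr
  have hAle : (1 + ‖z‖) ^ (-2 * (1 - γ)) ≤ A := hf.le_norm_div hγ0 hγ1 hz hz0
  have hp0 : 0 < (1 + ‖z‖) := by linarith
  have htan : ∀ δ, inner ℂ z δ = 0 → A * c ^ (-(1 / 2 : ℝ)) * ‖δ‖ ≤ ‖jacobian f z δ‖ := by
    intro δ hδ
    rcases eq_or_ne δ 0 with rfl | hδ0
    · simp
    obtain ⟨k, hk, h1, h2, h3⟩ := exists_tangent_rescale hz0 hδ hδ0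
    have h4 := le_norm_fderiv_sq_of_isMinOn hz0 hf.gStarlike.normalized.holomorphic hr1 hd hmin
      h1 h2
    rw [map_smul, norm_smul, Complex.norm_real, Real.norm_eq_abs, abs_of_pos hk] at h4
    rw [← sq_le_sq₀ (by positivity) (norm_nonneg _), mul_rpow_neg_half_sq hc, hA, ← h3]
    have h5 : (‖f z‖ / (k * ‖δ‖)) ^ 2 / c * ‖δ‖ ^ 2 =
        (inner ℂ (f z) (jacobian f z z)).re / k ^ 2 := by
      have := norm_pos_iff.2 hδ0
      rw [div_pow, ← hc3]
      field_simp
    rw [h5, div_le_iff₀ (by positivity)]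
    nlinarith
  have hv := (hf.gStarlike.nonsingular z hz).self_apply_inverse (f z)
  constructor
  · have := le_norm_det_mul (J := (jacobian f z).toLinearMap) (c := c)
      (m := A * c ^ (-(1 / 2 : ℝ))) hz0 (v := (jacobian f z).inverse (f z))
      (by change jacobian f z _ ≠ 0; rw [hv]; exact hf.ne_zero hz hz0) hc (by positivity) hc4
      (fun δ hδ => by
        change inner ℂ (jacobian f z _) (jacobian f z δ) = 0
        rw [hv]
        exact inner_fderiv_eq_zero_of_isExtrOn hz0 hd (Or.inl hmin) hδ)
      htan
    rw [ContinuousLinearMap.coe_coe, hv, finrank_Cn, mul_div_assoc, ← inv_div ‖f z‖ ‖z‖, ← hA,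
      ← div_le_iff₀ (by positivity), pow_mul_rpow_neg_half hA0 hc] at this
    refine le_trans ?_ this
    rw [Real.rpow_mul hp0.le, Real.rpow_natCast]
    gcongr ?_ ^ n * ?_
    exact Real.rpow_le_rpow_of_nonpos hc hc2 (by linarith [(Nat.cast_nonneg n : (0 : ℝ) ≤ n)])
  · intro δ hδ
    refine le_trans ?_ (htan δ hδ)
    gcongr ?_ * ?_ * _
    exact Real.rpow_le_rpow_of_nonpos hc hc2 (by norm_num)

end StarlikeDistortion

theorem corollary3p6 (n : ℕ) (γ : ℝ) (hγ0 : 0 < γ) (hγ1 : γ < 1)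
    (f : StarlikeDistortion.Cn n → StarlikeDistortion.Cn n)
    (hf : StarlikeDistortion.IsStarlikeOfOrder γ f)
    (z : StarlikeDistortion.Cn n) (hz : z ∈ StarlikeDistortion.unitBall n) (hz0 : z ≠ 0) :
    (IsMaxOn (fun ξ => ‖f ξ‖) (Metric.sphere 0 ‖z‖) z →
      ‖(StarlikeDistortion.jacobian f z).det‖ ≤
          (1 - ‖z‖) ^ (2 * (γ - 1) * (n : ℝ)) *
            ((1 - ‖z‖) / (1 + (1 - 2 * γ) * ‖z‖)) ^ (-(((n : ℝ) + 1) / 2)) ∧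
      ∀ δ ∈ StarlikeDistortion.holTangentSpace z,
        ‖StarlikeDistortion.jacobian f z δ‖ ≤
          (1 - ‖z‖) ^ (2 * (γ - 1)) *
            ((1 - ‖z‖) / (1 + (1 - 2 * γ) * ‖z‖)) ^ (-(1 / 2 : ℝ)) * ‖δ‖) ∧
    (IsMinOn (fun ξ => ‖f ξ‖) (Metric.sphere 0 ‖z‖) z →
      (1 + ‖z‖) ^ (-2 * (1 - γ) * (n : ℝ)) *
          ((1 + ‖z‖) / (1 - (1 - 2 * γ) * ‖z‖)) ^ (-(((n : ℝ) + 1) / 2)) ≤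
        ‖(StarlikeDistortion.jacobian f z).det‖ ∧
      ∀ δ ∈ StarlikeDistortion.holTangentSpace z,
        (1 + ‖z‖) ^ (-2 * (1 - γ)) *
            ((1 + ‖z‖) / (1 - (1 - 2 * γ) * ‖z‖)) ^ (-(1 / 2 : ℝ)) * ‖δ‖ ≤
          ‖StarlikeDistortion.jacobian f z δ‖) := by
  exact ⟨hf.distortion_of_isMaxOn hγ0 hγ1 hz hz0, hf.distortion_of_isMinOn hγ0 hγ1 hz hz0⟩
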